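/- Conventions. Fix an infinite cardinal $\kappa$. For each nonzero cardinal $n\le\kappa$ let $H_n=\ell^2(n)$, put $\mathcal M_n=\mathcal B(H_n)$ and $\mathcal M_{m,n}=\mathcal B(H_n,H_m)$, and give $\mathcal M_n$ its weak* (ultraweak) topology. Let $E$ be a dual operator space with distinguished (complete) predual operator space $E_*$. Then $\mathcal M_n(E)=\mathrm{CB}(E_*,\mathcal M_n)$, with the point-weak* topology. A compact nc convex set over $E$ is a graded set $K=\coprod_{0<n\le\kappa}K_n$ with $K_n\subseteq\mathcal M_n(E)$ compact for every $n$, such that (1) $\sum_i\alpha_ix_i\alpha_i^*\in K_n$ for every bounded family $x_i\in K_{n_i}$ and all isometries $\alpha_i\in\mathcal M_{n,n_i}$ with $\sum_i\alpha_i\alpha_i^*=1_n$; (2) $\beta^*x\beta\in K_m$ for every $x\in K_n$ and every isometry $\beta\in\mathcal M_{n,m}$. A continuous affine nc map $\theta:K\to L$ is a graded map ($\theta(K_n)\subseteq L_n$) which is continuous on each $K_n$, preserves the sums in (1), and satisfies $\theta(\beta^*x\beta)=\beta^*\theta(x)\beta$ for all isometries $\beta$ as in (2). Let $\mathrm{NCConv}$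 be the category of compact nc convex sets and continuous affine nc maps. A (closed) operator system is a complex $*$-vector space with a unit, matrix order and matrix norms that is (unitally, completely order isomorphically and completely isometrically) a norm closed unital self-adjoint subspace of some $\mathcal B(H)$. Let $\mathrm{OpSys}$ be the category of closed operator systems and unital completely positive (UCP) maps. For a compact nc convex set $K$, let $A(K)$ be the set of continuous affine nc functions $a:K\to\mathcal M=\coprod_n\mathcal M_n$ (graded maps, continuous on each $K_n$ for the weak* topology of $\mathcal M_n$, satisfying the same two affinity conditions). With the pointwise $*$-operation, the constant function $1$ as unit, the pointwise matrix order ($a\in\mathcal M_k(A(K))$ is positive iff $a(x)\ge0$ for all $x\in K$) and the uniform matrix norms, $A(K)$ is a closed operator system. For $\theta:K\to L$ put $A(\theta):A(L)\to A(K)$, $A(\theta)(b)(x)=b(\theta(x))$. For a closed operator system $S$, let $A^{-1}(S)$ be its nc state space, $\coprod_n\mathrm{UCP}(S,\mathcal M_n)$, a compact nc convex set over $S^*$. For a UCP map $\varphi:T\to S$ let $A^{-1}(\varphi):A^{-1}(S)\to A^{-1}(T)$ be $x\mapsto x\circ\varphi$. Theorem. (a) Let $S$ be a closed operator system with nc state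 space $K$. For $s\in S$ the function $\hat s(x)=x(s)$ ($x\in K$) is a continuous affine nc function on $K$, and $s\mapsto\hat s$ is a unital complete order isomorphism of $S$ onto $A(K)$. (b) $A:\mathrm{NCConv}\to\mathrm{OpSys}$ and $A^{-1}:\mathrm{OpSys}\to\mathrm{NCConv}$ are contravariant functors which are inverse to each other up to natural isomorphism: the maps $K\to A^{-1}(A(K))$, $x\mapsto(a\mapsto a(x))$, and $S\to A(A^{-1}(S))$, $s\mapsto\hat s$, are natural isomorphisms. In particular, $\mathrm{NCConv}$ and $\mathrm{OpSys}$ are dually equivalent. -/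

import Mathlib

open CategoryTheory Filter Topology
open scoped InnerProductSpace ComplexOrder ENNReal

universe u

noncomputable section

namespace NCConvex

section Operators

variable {H : Type u} [NormedAddCommGroup H] [InnerProductSpace ℂ H]

/-- A matrix `[a i j]` of bounded operators on `H`, viewed as a bounded operator on the
Hilbert space direct sum `H ⊕ ⋯ ⊕ H`. -/
def opMatrix {ι : Type*} [Fintype ι] (a : Matrix ι ι (H →L[ℂ] H)) :
    PiLp 2 (fun _ : ι => H) →L[ℂ] PiLp 2 (fun _ : ι => H) :=
  (PiLp.continuousLinearEquiv 2 ℂ (fun _ : ι => H)).symm.toContinuousLinearMap ∘L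
    ContinuousLinearMap.pi (fun i => ∑ j, a i j ∘L PiLp.proj 2 (fun _ : ι => H) j)

/-- The pairing of a bounded operator with the normal functional
`T ↦ ∑ₖ ⟪ηₖ, T ξₖ⟫` given by two square summable sequences of vectors. -/
def pairing (p : lp (fun _ : ℕ => H) 2 × lp (fun _ : ℕ => H) 2) (T : H →L[ℂ] H) : ℂ :=
  ∑' k, ⟪p.2 k, T (p.1 k)⟫_ℂ

/-- The weak* (i.e. ultraweak) topology on `B(H)`, the dual of the trace class operators: the
coarsest topology making all functionals `T ↦ ∑ₖ ⟪ηₖ, T ξₖ⟫` continuous. -/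
abbrev weakStar (H : Type u) [NormedAddCommGroup H] [InnerProductSpace ℂ H] :
    TopologicalSpace (H →L[ℂ] H) :=
  TopologicalSpace.induced
    (fun T (p : lp (fun _ : ℕ => H) 2 × lp (fun _ : ℕ => H) 2) => pairing p T)
    Pi.topologicalSpace

/-- The point-weak* topology on linear maps from `V` to `B(H)`. -/
abbrev pointWeakStar (V : Type u) [AddCommGroup V] [Module ℂ V]
    (H : Type u) [NormedAddCommGroup H] [InnerProductSpace ℂ H] :
    TopologicalSpace (V →ₗ[ℂ] (H →L[ℂ] H)) :=
  TopologicalSpace.induced (fun φ (v : V) => φ v)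
    (@Pi.topologicalSpace V (fun _ => H →L[ℂ] H) (fun _ => weakStar H))

/-- `∑ᵢ Tᵢ = T`, unconditionally, in the weak* topology of `B(H)`. -/
def WeakStarHasSum {I : Type u} (T : I → (H →L[ℂ] H)) (S : H →L[ℂ] H) : Prop :=
  @HasSum (H →L[ℂ] H) I _ (weakStar H) T S (.unconditional I)

/-- `∑ᵢ φᵢ = φ`, unconditionally, in the point-weak* topology. -/
def PointWeakStarHasSum {V : Type u} [AddCommGroup V] [Module ℂ V] {I : Type u}
    (φ : I → (V →ₗ[ℂ] (H →L[ℂ] H))) (ψ : V →ₗ[ℂ] (H →L[ℂ] H)) : Prop :=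
  @HasSum (V →ₗ[ℂ] (H →L[ℂ] H)) I _ (pointWeakStar V H) φ ψ (.unconditional I)

end Operators

section OperatorLemmas

variable {H : Type u} [NormedAddCommGroup H] [InnerProductSpace ℂ H]

theorem opMatrix_apply {ι : Type*} [Fintype ι] (a : Matrix ι ι (H →L[ℂ] H))
    (ξ : PiLp 2 (fun _ : ι => H)) (i : ι) : opMatrix a ξ i = ∑ j, a i j (ξ j) := by
  simp [opMatrix]

theorem inner_opMatrix {ι : Type*} [Fintype ι] (a : Matrix ι ι (H →L[ℂ] H))
    (ξ η : PiLp 2 (fun _ : ι => H)) :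
    ⟪η, opMatrix a ξ⟫_ℂ = ∑ i, ∑ j, ⟪η i, a i j (ξ j)⟫_ℂ := by
  simp [PiLp.inner_apply, opMatrix_apply, inner_sum]

theorem isPositive_iff_nonneg (T : H →L[ℂ] H) :
    T.IsPositive ↔ ∀ x, 0 ≤ ⟪x, T x⟫_ℂ := by
  constructor
  · intro h x; exact h.inner_nonneg_right x
  · intro h
    rw [ContinuousLinearMap.isPositive_iff_complex]
    intro x
    have h1 := h x
    rw [← inner_conj_symm] at h1
    have h2 : 0 ≤ ⟪T x, x⟫_ℂ := by
      have := star_nonneg_iff.mpr h1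
      simpa using this
    rw [Complex.nonneg_iff] at h2
    refine ⟨?_, h2.1⟩
    apply Complex.ext <;> simp [← h2.2]

theorem opMatrix_isPositive_iff {ι : Type*} [Fintype ι] (a : Matrix ι ι (H →L[ℂ] H)) :
    (opMatrix a).IsPositive ↔ ∀ ξ : ι → H, 0 ≤ ∑ i, ∑ j, ⟪ξ i, a i j (ξ j)⟫_ℂ := by
  rw [isPositive_iff_nonneg]
  constructor
  · intro h ξ
    have := h (WithLp.toLp 2 ξ)
    simpa [inner_opMatrix] using this
  · intro h ξ
    rw [inner_opMatrix]
    exact h _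

theorem opMatrix_reindex {ι κ : Type*} [Fintype ι] [Fintype κ] (e : ι ≃ κ)
    (a : Matrix ι ι (H →L[ℂ] H)) :
    (opMatrix (a.submatrix e.symm e.symm)).IsPositive ↔ (opMatrix a).IsPositive := by
  rw [opMatrix_isPositive_iff, opMatrix_isPositive_iff]
  constructor
  · intro h ξ
    have := h (ξ ∘ e.symm)
    simp only [Matrix.submatrix_apply, Function.comp] at this
    rw [e.symm.sum_comp (fun i => ∑ j, ⟪ξ i, a i (e.symm j) (ξ (e.symm j))⟫_ℂ)] at this
    simpa only [fun i => e.symm.sum_comp (fun j => ⟪ξ i, a i j (ξ j)⟫_ℂ)] using this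
  · intro h ξ
    have := h (ξ ∘ e)
    rw [← e.symm.sum_comp] at this
    simp_rw [fun i => (e.symm.sum_comp (fun j => ⟪(ξ ∘ e) i, a i j ((ξ ∘ e) j)⟫_ℂ)).symm] at this
    simpa using this

/-- Compressing an operator matrix entrywise by an operator. -/
theorem opMatrix_conj_isPositive {G : Type u} [NormedAddCommGroup G] [InnerProductSpace ℂ G]
    [CompleteSpace G] [CompleteSpace H] {ι : Type*} [Fintype ι] (a : Matrix ι ι (H →L[ℂ] H))
    (β : G →L[ℂ] H) (h : (opMatrix a).IsPositive) :
    (opMatrix (a.map fun T => ContinuousLinearMap.adjoint β ∘L T ∘L β)).IsPositive := by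
  rw [opMatrix_isPositive_iff] at *
  intro ξ
  simpa [ContinuousLinearMap.adjoint_inner_right] using h (fun i => β (ξ i))

theorem norm_toLp_comp_le {G : Type u} [NormedAddCommGroup G] [InnerProductSpace ℂ G]
    {ι : Type*} [Fintype ι] (β : G →L[ℂ] H) (hβ : ∀ x, ‖β x‖ ≤ ‖x‖)
    (ξ : PiLp 2 (fun _ : ι => G)) :
    ‖(WithLp.toLp 2 (fun i => β (ξ i)) : PiLp 2 (fun _ : ι => H))‖ ≤ ‖ξ‖ := by
  rw [PiLp.norm_eq_of_L2, PiLp.norm_eq_of_L2]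
  apply Real.sqrt_le_sqrt
  apply Finset.sum_le_sum
  intro i _
  simpa using pow_le_pow_left₀ (norm_nonneg _) (hβ (ξ i)) 2

theorem opNorm_le_of_inner {G : Type*} [NormedAddCommGroup G] [InnerProductSpace ℂ G]
    (T : G →L[ℂ] G) {C : ℝ} (hC : 0 ≤ C) (h : ∀ x y, ‖⟪y, T x⟫_ℂ‖ ≤ C * ‖x‖ * ‖y‖) :
    ‖T‖ ≤ C := by
  refine T.opNorm_le_bound hC fun x => ?_
  have h1 := h x (T x)
  rw [inner_self_eq_norm_sq_to_K] at h1
  simp only [norm_pow, Complex.coe_algebraMap, Complex.norm_real, norm_norm] at h1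
  rcases (norm_nonneg (T x)).eq_or_lt with h2 | h2
  · rw [← h2]; positivity
  · rw [sq] at h1
    exact le_of_mul_le_mul_right h1 h2

theorem norm_opMatrix_conj_le {G : Type u} [NormedAddCommGroup G] [InnerProductSpace ℂ G]
    [CompleteSpace G] [CompleteSpace H] {ι : Type*} [Fintype ι] (a : Matrix ι ι (H →L[ℂ] H))
    (β : G →L[ℂ] H) (hβ : ∀ x, ‖β x‖ ≤ ‖x‖) :
    ‖opMatrix (a.map fun T => ContinuousLinearMap.adjoint β ∘L T ∘L β)‖ ≤ ‖opMatrix a‖ := by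
  refine opNorm_le_of_inner _ (norm_nonneg _) fun ξ η => ?_
  have h1 : ⟪η, opMatrix (a.map fun T => ContinuousLinearMap.adjoint β ∘L T ∘L β) ξ⟫_ℂ =
      ⟪(WithLp.toLp 2 (fun i => β (η i)) : PiLp 2 (fun _ : ι => H)),
        opMatrix a (WithLp.toLp 2 (fun i => β (ξ i)))⟫_ℂ := by
    simp [inner_opMatrix, ContinuousLinearMap.adjoint_inner_right]
  rw [h1]
  have h2 := norm_toLp_comp_le β hβ ξ
  have h3 := norm_toLp_comp_le β hβ η
  calc _ ≤ _ := norm_inner_le_norm _ _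
    _ ≤ ‖η‖ * (‖opMatrix a‖ * ‖ξ‖) := by
      gcongr
      exact (ContinuousLinearMap.le_opNorm _ _).trans (by gcongr)
    _ = _ := by ring

/-- The value of the quadratic form of a `2 × 2` block matrix with scalar diagonal. -/
theorem inner_block {ι : Type*} [Fintype ι] [DecidableEq ι] (t : ℝ)
    (B C : Matrix ι ι (H →L[ℂ] H)) (u v : PiLp 2 (fun _ : ι => H)) :
    ∑ i, ∑ j, ⟪Sum.elim u v i, (Matrix.fromBlocks (Matrix.diagonal fun _ => (t : ℂ) • 1) B C
      (Matrix.diagonal fun _ => (t : ℂ) • 1) : Matrix (ι ⊕ ι) (ι ⊕ ι) (H →L[ℂ] H)) i j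
        (Sum.elim u v j)⟫_ℂ
      = t * (‖u‖ ^ 2 + ‖v‖ ^ 2 : ℝ) + ⟪u, opMatrix B v⟫_ℂ + ⟪v, opMatrix C u⟫_ℂ := by
  have key : ∀ w : PiLp 2 (fun _ : ι => H),
      ∑ i, ∑ j, ⟪w i, (Matrix.diagonal (fun _ => (t : ℂ) • (1 : H →L[ℂ] H)) i j) (w j)⟫_ℂ
        = t * (‖w‖ ^ 2 : ℝ) := by
    intro w
    have h1 : ∀ i, ∑ j, ⟪w i, (Matrix.diagonal (fun _ => (t : ℂ) • (1 : H →L[ℂ] H)) i j) (w j)⟫_ℂ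
        = t * ⟪w i, w i⟫_ℂ := by
      intro i
      rw [Finset.sum_eq_single i]
      · simp
      · intro j _ hj; simp [Matrix.diagonal_apply_ne _ hj.symm]
      · simp
    simp_rw [h1, ← Finset.mul_sum, ← PiLp.inner_apply]
    rw [inner_self_eq_norm_sq_to_K]
    simp
  simp only [Fintype.sum_sum_type, Sum.elim_inl, Sum.elim_inr, Matrix.fromBlocks_apply₁₁,
    Matrix.fromBlocks_apply₁₂, Matrix.fromBlocks_apply₂₁, Matrix.fromBlocks_apply₂₂,
    Finset.sum_add_distrib, key, inner_opMatrix]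
  push_cast
  ring

theorem block_isPositive [CompleteSpace H] {ι : Type*} [Fintype ι] [DecidableEq ι] {t : ℝ}
    {B : Matrix ι ι (H →L[ℂ] H)} (h : ‖opMatrix B‖ ≤ t) :
    (opMatrix (Matrix.fromBlocks (Matrix.diagonal fun _ => (t : ℂ) • 1) B
      (B.transpose.map ContinuousLinearMap.adjoint)
      (Matrix.diagonal fun _ => (t : ℂ) • 1) :
        Matrix (ι ⊕ ι) (ι ⊕ ι) (H →L[ℂ] H))).IsPositive := by
  rw [opMatrix_isPositive_iff]
  intro ξ
  have h0 := inner_block t B (B.transpose.map ContinuousLinearMap.adjoint)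
    (WithLp.toLp 2 (ξ ∘ Sum.inl)) (WithLp.toLp 2 (ξ ∘ Sum.inr))
  set u : PiLp 2 (fun _ : ι => H) := WithLp.toLp 2 (ξ ∘ Sum.inl)
  set v : PiLp 2 (fun _ : ι => H) := WithLp.toLp 2 (ξ ∘ Sum.inr)
  have h1 : Sum.elim (u : ι → H) (v : ι → H) = ξ := by
    ext x; cases x <;> rfl
  rw [h1] at h0
  rw [h0]
  have h2 : ⟪v, opMatrix (B.transpose.map ContinuousLinearMap.adjoint) u⟫_ℂ
      = (starRingEnd ℂ) ⟪u, opMatrix B v⟫_ℂ := by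
    rw [inner_opMatrix, inner_opMatrix, Finset.sum_comm]
    simp [ContinuousLinearMap.adjoint_inner_right, map_sum]
  rw [h2, add_assoc, Complex.add_conj, ← Complex.ofReal_mul, ← Complex.ofReal_add]
  rw [Complex.zero_le_real]
  have h3 : |(⟪u, opMatrix B v⟫_ℂ).re| ≤ ‖u‖ * (t * ‖v‖) :=
    (Complex.abs_re_le_norm _).trans ((norm_inner_le_norm _ _).trans (by
      gcongr
      exact (ContinuousLinearMap.le_opNorm _ _).trans (by gcongr)))
  have h4 := (abs_le.mp h3).1
  have ht : 0 ≤ t := (norm_nonneg _).trans h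
  nlinarith [mul_nonneg ht (sq_nonneg (‖u‖ - ‖v‖))]

theorem norm_le_of_block {ι : Type*} [Fintype ι] [DecidableEq ι] {t : ℝ} (ht : 0 < t)
    {B C : Matrix ι ι (H →L[ℂ] H)}
    (h : (opMatrix (Matrix.fromBlocks (Matrix.diagonal fun _ => (t : ℂ) • 1) B C
      (Matrix.diagonal fun _ => (t : ℂ) • 1) :
        Matrix (ι ⊕ ι) (ι ⊕ ι) (H →L[ℂ] H))).IsPositive) : ‖opMatrix B‖ ≤ t := by
  rw [opMatrix_isPositive_iff] at h
  have h1 : ∀ u v : PiLp 2 (fun _ : ι => H),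
      0 ≤ t * (‖u‖ ^ 2 + ‖v‖ ^ 2 : ℝ) + ⟪u, opMatrix B v⟫_ℂ + ⟪v, opMatrix C u⟫_ℂ := by
    intro u v
    rw [← inner_block]
    exact h _
  have h2 : ∀ u v : PiLp 2 (fun _ : ι => H),
      (⟪v, opMatrix C u⟫_ℂ).re = (⟪u, opMatrix B v⟫_ℂ).re := by
    intro u v
    have h3 := (Complex.nonneg_iff.mp (h1 u (Complex.I • v))).2
    simp only [map_smul, inner_smul_left, inner_smul_right] at h3
    simp only [Complex.add_im, Complex.mul_im, Complex.conj_I, Complex.neg_re, Complex.neg_im,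
      Complex.I_re, Complex.I_im, Complex.ofReal_im, Complex.ofReal_re] at h3
    linarith
  refine ContinuousLinearMap.opNorm_le_bound _ ht.le fun v => ?_
  have h3 := (Complex.nonneg_iff.mp (h1 (-((t⁻¹ : ℝ) : ℂ) • opMatrix B v) v)).1
  rw [Complex.add_re, h2, Complex.add_re] at h3
  rw [inner_smul_left, inner_self_eq_norm_sq_to_K, norm_smul] at h3
  set b := ‖opMatrix B v‖
  simp only [norm_neg, Complex.norm_real, Real.norm_eq_abs, abs_of_pos (inv_pos.mpr ht), map_neg,
    Complex.conj_ofReal, Complex.coe_algebraMap] at h3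
  rw [← Complex.ofReal_mul, Complex.ofReal_re, ← Complex.ofReal_neg, ← Complex.ofReal_pow,
    ← Complex.ofReal_mul, Complex.ofReal_re] at h3
  have h4 : t * ((t⁻¹ * b) ^ 2 + ‖v‖ ^ 2) + -t⁻¹ * b ^ 2 + -t⁻¹ * b ^ 2
      = t⁻¹ * ((t * ‖v‖) ^ 2 - b ^ 2) := by
    field_simp; ring
  rw [h4] at h3
  have h5 : 0 ≤ (t * ‖v‖) ^ 2 - b ^ 2 := nonneg_of_mul_nonneg_right h3 (inv_pos.mpr ht)
  exact abs_le_of_sq_le_sq' (by linarith) (by positivity) |>.2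

end OperatorLemmas

section WeakStarLemmas

variable {H : Type u} [NormedAddCommGroup H] [InnerProductSpace ℂ H]

theorem summable_norm_mul {H : Type u} [NormedAddCommGroup H]
    (p : lp (fun _ : ℕ => H) 2 × lp (fun _ : ℕ => H) 2) :
    Summable fun k => ‖p.2 k‖ * ‖p.1 k‖ := by
  have h1 := (lp.memℓp p.1).summable (by norm_num)
  have h2 := (lp.memℓp p.2).summable (by norm_num)
  refine Summable.of_nonneg_of_le (fun k => by positivity) (fun k => ?_) (h1.add h2)
  simp only [ENNReal.toReal_ofNat, Real.rpow_ofNat]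
  nlinarith [sq_nonneg (‖p.1 k‖ - ‖p.2 k‖), sq_nonneg (‖p.1 k‖), sq_nonneg (‖p.2 k‖)]

theorem norm_pairing_term_le (p : lp (fun _ : ℕ => H) 2 × lp (fun _ : ℕ => H) 2)
    {T : H →L[ℂ] H} {C : ℝ} (hT : ‖T‖ ≤ C) (k : ℕ) :
    ‖⟪p.2 k, T (p.1 k)⟫_ℂ‖ ≤ C * (‖p.2 k‖ * ‖p.1 k‖) := by
  calc _ ≤ ‖p.2 k‖ * ‖T (p.1 k)‖ := norm_inner_le_norm _ _
    _ ≤ ‖p.2 k‖ * (C * ‖p.1 k‖) := by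
      gcongr
      exact (T.le_opNorm _).trans (by gcongr)
    _ = _ := by ring

theorem summable_pairing (p : lp (fun _ : ℕ => H) 2 × lp (fun _ : ℕ => H) 2) (T : H →L[ℂ] H) :
    Summable fun k => ⟪p.2 k, T (p.1 k)⟫_ℂ :=
  Summable.of_norm_bounded ((summable_norm_mul p).mul_left ‖T‖)
    (norm_pairing_term_le p le_rfl)

/-- The pairing as a linear functional. -/
def pairingₗ (p : lp (fun _ : ℕ => H) 2 × lp (fun _ : ℕ => H) 2) : (H →L[ℂ] H) →ₗ[ℂ] ℂ where
  toFun := pairing p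
  map_add' S T := by
    simp only [pairing, add_apply, inner_add_right]
    exact (summable_pairing p S).tsum_add (summable_pairing p T)
  map_smul' c T := by
    simp only [pairing, smul_apply, inner_smul_right, RingHom.id_apply,
      smul_eq_mul]
    exact tsum_mul_left

theorem norm_pairing_le (p : lp (fun _ : ℕ => H) 2 × lp (fun _ : ℕ => H) 2)
    {T : H →L[ℂ] H} {C : ℝ} (hT : ‖T‖ ≤ C) :
    ‖pairing p T‖ ≤ C * ∑' k, ‖p.2 k‖ * ‖p.1 k‖ := by
  rw [← tsum_mul_left]
  exact tsum_of_norm_bounded ((summable_norm_mul p).mul_left C).hasSum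
    (norm_pairing_term_le p hT)

/-- The two one-term sequences given by two vectors. -/
def vecPair (ξ η : H) : lp (fun _ : ℕ => H) 2 × lp (fun _ : ℕ => H) 2 :=
  (lp.single 2 0 ξ, lp.single 2 0 η)

theorem pairing_vecPair (ξ η : H) (T : H →L[ℂ] H) : pairing (vecPair ξ η) T = ⟪η, T ξ⟫_ℂ := by
  rw [pairing, tsum_eq_single 0]
  · simp [vecPair]
  · intro k hk
    simp [vecPair, hk]

theorem tendsto_weakStar {X : Type*} {l : Filter X} {f : X → (H →L[ℂ] H)} {T : H →L[ℂ] H} :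
    Tendsto f l (@nhds _ (weakStar H) T) ↔
      ∀ p, Tendsto (fun x => pairing p (f x)) l (𝓝 (pairing p T)) := by
  rw [nhds_induced, tendsto_comap_iff, tendsto_pi_nhds]
  rfl

theorem continuous_weakStar {X : Type*} [t : TopologicalSpace X] {f : X → (H →L[ℂ] H)} :
    @Continuous _ _ t (weakStar H) f ↔ ∀ p, Continuous fun x => pairing p (f x) := by
  rw [continuous_induced_rng, continuous_pi_iff]
  rfl

theorem tendsto_pointWeakStar {V : Type u} [AddCommGroup V] [Module ℂ V]
    {X : Type*} {l : Filter X} {f : X → (V →ₗ[ℂ] (H →L[ℂ] H))} {φ : V →ₗ[ℂ] (H →L[ℂ] H)} :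
    Tendsto f l (@nhds _ (pointWeakStar V H) φ) ↔
      ∀ v p, Tendsto (fun x => pairing p (f x v)) l (𝓝 (pairing p (φ v))) := by
  let _ := weakStar H
  rw [nhds_induced, tendsto_comap_iff, tendsto_pi_nhds]
  exact forall_congr' fun v => tendsto_weakStar

theorem continuous_pointWeakStar {V : Type u} [AddCommGroup V] [Module ℂ V]
    {X : Type*} [t : TopologicalSpace X] {f : X → (V →ₗ[ℂ] (H →L[ℂ] H))} :
    @Continuous _ _ t (pointWeakStar V H) f ↔ ∀ v p, Continuous fun x => pairing p (f x v) := by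
  let _ := weakStar H
  rw [continuous_induced_rng, continuous_pi_iff]
  exact forall_congr' fun v => continuous_weakStar

theorem weakStarHasSum_iff {I : Type u} {T : I → (H →L[ℂ] H)} {S : H →L[ℂ] H} :
    WeakStarHasSum T S ↔ ∀ p, HasSum (fun i => pairing p (T i)) (pairing p S) := by
  unfold WeakStarHasSum HasSum
  rw [tendsto_weakStar]
  refine forall_congr' fun p => ?_
  have : ∀ s : Finset I, pairing p (∑ i ∈ s, T i) = ∑ i ∈ s, pairing p (T i) :=
    fun s => map_sum (pairingₗ p) _ _
  simp_rw [this]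

theorem pointWeakStarHasSum_iff {V : Type u} [AddCommGroup V] [Module ℂ V] {I : Type u}
    {φ : I → (V →ₗ[ℂ] (H →L[ℂ] H))} {ψ : V →ₗ[ℂ] (H →L[ℂ] H)} :
    PointWeakStarHasSum φ ψ ↔ ∀ v, WeakStarHasSum (fun i => φ i v) (ψ v) := by
  simp_rw [weakStarHasSum_iff]
  unfold PointWeakStarHasSum HasSum
  rw [tendsto_pointWeakStar]
  refine forall_congr' fun v => forall_congr' fun p => ?_
  have : ∀ s : Finset I, pairing p ((∑ i ∈ s, φ i) v) = ∑ i ∈ s, pairing p (φ i v) := by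
    intro s
    rw [LinearMap.sum_apply]
    exact map_sum (pairingₗ p) _ _
  simp_rw [this]

theorem WeakStarHasSum.inner {I : Type u} {T : I → (H →L[ℂ] H)} {S : H →L[ℂ] H}
    (h : WeakStarHasSum T S) (ξ η : H) : HasSum (fun i => ⟪η, T i ξ⟫_ℂ) ⟪η, S ξ⟫_ℂ := by
  have := weakStarHasSum_iff.mp h (vecPair ξ η)
  simpa only [pairing_vecPair] using this

theorem WeakStarHasSum.unique {I : Type u} {T : I → (H →L[ℂ] H)} {S S' : H →L[ℂ] H}
    (h : WeakStarHasSum T S) (h' : WeakStarHasSum T S') : S = S' := by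
  ext ξ
  exact ext_inner_left ℂ fun η => (h.inner ξ η).unique (h'.inner ξ η)

theorem WeakStarHasSum.comp_left [CompleteSpace H] {I : Type u} {T : I → (H →L[ℂ] H)}
    {S : H →L[ℂ] H} (h : WeakStarHasSum T S) (R : H →L[ℂ] H) :
    WeakStarHasSum (fun i => R ∘L T i) (R ∘L S) := by
  rw [weakStarHasSum_iff] at *
  intro p
  have := h (p.1, lp.mapCLM 2 (fun _ => ContinuousLinearMap.adjoint R) (norm_nonneg _)
    (fun _ => le_rfl) p.2)
  simpa [pairing, ContinuousLinearMap.adjoint_inner_left] using this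

end WeakStarLemmas

section Decompositions

variable {H : Type u} [NormedAddCommGroup H] [InnerProductSpace ℂ H] [CompleteSpace H]
  {I : Type u} {G : I → Type u} [∀ i, NormedAddCommGroup (G i)] [∀ i, InnerProductSpace ℂ (G i)]
  [∀ i, CompleteSpace (G i)]

/-- A family of isometries `αᵢ : Gᵢ → H` with `∑ᵢ αᵢ αᵢ* = 1`. -/
def IsIsometryDecomposition (α : ∀ i, G i →L[ℂ] H) : Prop :=
  (∀ i, ContinuousLinearMap.adjoint (α i) ∘L α i = 1) ∧
    WeakStarHasSum (fun i => α i ∘L ContinuousLinearMap.adjoint (α i)) (1 : H →L[ℂ] H)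

theorem isometry_adjoint_apply {G : Type u} [NormedAddCommGroup G] [InnerProductSpace ℂ G]
    [CompleteSpace G] {α : G →L[ℂ] H} (h : ContinuousLinearMap.adjoint α ∘L α = 1) (x : G) :
    ContinuousLinearMap.adjoint α (α x) = x := by
  have := congrArg (fun T => T x) h
  simpa using this

theorem isometry_norm {G : Type u} [NormedAddCommGroup G] [InnerProductSpace ℂ G]
    [CompleteSpace G] {α : G →L[ℂ] H} (h : ContinuousLinearMap.adjoint α ∘L α = 1) (x : G) :
    ‖α x‖ = ‖x‖ := by
  have h1 : ⟪α x, α x⟫_ℂ = ⟪x, x⟫_ℂ := by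
    rw [← ContinuousLinearMap.adjoint_inner_right, isometry_adjoint_apply h]
  rw [@norm_eq_sqrt_re_inner ℂ, @norm_eq_sqrt_re_inner ℂ _ _ _ _ x, h1]

theorem IsIsometryDecomposition.adjoint_apply_ne {α : ∀ i, G i →L[ℂ] H}
    (h : IsIsometryDecomposition α) {i j : I} (hij : i ≠ j) (x : G j) :
    ContinuousLinearMap.adjoint (α i) (α j x) = 0 := by
  have h1 := h.2.inner (α j x) (α j x)
  have h2 : ∀ i, ⟪α j x, (α i ∘L ContinuousLinearMap.adjoint (α i)) (α j x)⟫_ℂ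
      = ((‖ContinuousLinearMap.adjoint (α i) (α j x)‖ ^ 2 : ℝ) : ℂ) := by
    intro i
    rw [ContinuousLinearMap.comp_apply, ← ContinuousLinearMap.adjoint_inner_left,
      inner_self_eq_norm_sq_to_K]
    simp
  simp_rw [h2] at h1
  have h3 : ⟪α j x, (1 : H →L[ℂ] H) (α j x)⟫_ℂ
      = ((‖ContinuousLinearMap.adjoint (α j) (α j x)‖ ^ 2 : ℝ) : ℂ) := by
    rw [isometry_adjoint_apply (h.1 j), one_apply_eq_self, inner_self_eq_norm_sq_to_K,
      isometry_norm (h.1 j)]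
    simp
  rw [h3, Complex.hasSum_ofReal] at h1
  classical
  have h4 := sum_le_hasSum ({i, j} : Finset I) (fun k _ => by positivity) h1
  rw [Finset.sum_pair hij] at h4
  have h5 : ‖ContinuousLinearMap.adjoint (α i) (α j x)‖ ^ 2 = 0 :=
    le_antisymm (by linarith) (by positivity)
  simpa using h5

/-- For a family of isometries with `∑ᵢ αᵢ αᵢ* = 1`, the identity `T = ∑ᵢ αᵢ Tᵢ αᵢ*` holds if and
only if `T αᵢ = αᵢ Tᵢ` for all `i`. -/
theorem IsIsometryDecomposition.hasSum_iff {α : ∀ i, G i →L[ℂ] H}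
    (h : IsIsometryDecomposition α) {T : ∀ i, G i →L[ℂ] G i} {S : H →L[ℂ] H} :
    WeakStarHasSum (fun i => α i ∘L T i ∘L ContinuousLinearMap.adjoint (α i)) S ↔
      ∀ i x, S (α i x) = α i (T i x) := by
  constructor
  · intro hS i x
    refine ext_inner_left ℂ fun η => ?_
    refine (hS.inner (α i x) η).unique ?_
    have h1 := hasSum_single (f := fun j => ⟪η, (α j ∘L T j ∘L ContinuousLinearMap.adjoint (α j))
      (α i x)⟫_ℂ) i (fun j hj => by simp [h.adjoint_apply_ne hj])
    simpa [isometry_adjoint_apply (h.1 i)] using h1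
  · intro hS
    have h1 : (fun i => α i ∘L T i ∘L ContinuousLinearMap.adjoint (α i))
        = fun i => S ∘L (α i ∘L ContinuousLinearMap.adjoint (α i)) := by
      ext i x
      simp [hS]
    have h2 := h.2.comp_left S
    rw [h1]
    rwa [show S ∘L (1 : H →L[ℂ] H) = S from ContinuousLinearMap.comp_id S] at h2

end Decompositions

/-! ### Operator spaces and operator systems -/

/-- The linear map `ι` into `B(H)` is completely isometric for the given matrix norms. -/
def IsCompletelyIsometric {V : Type u} [AddCommGroup V] [Module ℂ V]
    (mnorm : ∀ n : ℕ, Matrix (Fin n) (Fin n) V → ℝ)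
    {H : Type u} [NormedAddCommGroup H] [InnerProductSpace ℂ H]
    (ι : V →ₗ[ℂ] (H →L[ℂ] H)) : Prop :=
  ∀ n (a : Matrix (Fin n) (Fin n) V), mnorm n a = ‖opMatrix (a.map ι)‖

/-- The linear map `ι` into `B(H)` preserves and reflects the given matrix order. -/
def IsCompleteOrderEmbedding {V : Type u} [AddCommGroup V] [Module ℂ V]
    (cone : ∀ n : ℕ, Set (Matrix (Fin n) (Fin n) V))
    {H : Type u} [NormedAddCommGroup H] [InnerProductSpace ℂ H]
    (ι : V →ₗ[ℂ] (H →L[ℂ] H)) : Prop :=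
  ∀ n (a : Matrix (Fin n) (Fin n) V), a ∈ cone n ↔ (opMatrix (a.map ι)).IsPositive

/-- An operator space: a complex vector space with a sequence of matrix norms which is completely
isometric to a norm closed subspace of `B(H)` for some Hilbert space `H`. -/
structure OperatorSpace : Type (u + 1) where
  carrier : Type u
  [addCommGroup : AddCommGroup carrier]
  [module : Module ℂ carrier]
  /-- The norm on `n × n` matrices. -/
  mnorm : ∀ n : ℕ, Matrix (Fin n) (Fin n) carrier → ℝ
  exists_rep : ∃ (H : Type u) (_ : NormedAddCommGroup H) (_ : InnerProductSpace ℂ H)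
    (_ : CompleteSpace H) (ι : carrier →ₗ[ℂ] (H →L[ℂ] H)),
      Function.Injective ι ∧ IsClosed (Set.range ι) ∧ IsCompletelyIsometric mnorm ι

attribute [instance] OperatorSpace.addCommGroup OperatorSpace.module

/-- A closed operator system: a complex `*`-vector space with a unit, a sequence of matrix cones
and a sequence of matrix norms, which is unitally completely order isomorphic (and completely
isometric) to a norm closed unital self-adjoint subspace of `B(H)` for some Hilbert space `H`. -/
structure OperatorSystem : Type (u + 1) where
  carrier : Type u
  [addCommGroup : AddCommGroup carrier]
  [module : Module ℂ carrier]
  [starAddMonoid : StarAddMonoid carrier]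
  [starModule : StarModule ℂ carrier]
  [one : One carrier]
  /-- The positive `n × n` matrices. -/
  cone : ∀ n : ℕ, Set (Matrix (Fin n) (Fin n) carrier)
  /-- The norm on `n × n` matrices. -/
  mnorm : ∀ n : ℕ, Matrix (Fin n) (Fin n) carrier → ℝ
  exists_rep : ∃ (H : Type u) (_ : NormedAddCommGroup H) (_ : InnerProductSpace ℂ H)
    (_ : CompleteSpace H) (ι : carrier →ₗ[ℂ] (H →L[ℂ] H)),
      Function.Injective ι ∧ IsClosed (Set.range ι) ∧
      ι 1 = 1 ∧ (∀ s, ι (star s) = ContinuousLinearMap.adjoint (ι s)) ∧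
      IsCompleteOrderEmbedding cone ι ∧ IsCompletelyIsometric mnorm ι

attribute [instance] OperatorSystem.addCommGroup OperatorSystem.module
  OperatorSystem.starAddMonoid OperatorSystem.starModule OperatorSystem.one

/-- The operator space underlying an operator system. -/
def OperatorSystem.toOperatorSpace (S : OperatorSystem.{u}) : OperatorSpace.{u} where
  carrier := S.carrier
  mnorm := S.mnorm
  exists_rep := by
    obtain ⟨H, h1, h2, h3, ι, h4, h5, -, -, -, h6⟩ := S.exists_rep
    exact ⟨H, h1, h2, h3, ι, h4, h5, h6⟩

/-- A unital completely positive map of operator systems. -/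
@[ext]
structure UCPMap (S T : OperatorSystem.{u}) where
  toLinearMap : S.carrier →ₗ[ℂ] T.carrier
  map_one : toLinearMap 1 = 1
  map_cone : ∀ n (a : Matrix (Fin n) (Fin n) S.carrier), a ∈ S.cone n →
    a.map toLinearMap ∈ T.cone n

/-- The category of closed operator systems and unital completely positive maps. -/
instance : Category OperatorSystem.{u} where
  Hom := UCPMap
  id S := ⟨LinearMap.id, rfl, fun n a ha => by simpa using ha⟩
  comp f g := ⟨g.toLinearMap ∘ₗ f.toLinearMap, by simp [f.map_one, g.map_one], fun n a ha => by
    have := g.map_cone n _ (f.map_cone n a ha)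
    simpa [Matrix.map_map] using this⟩

/-! ### Compact nc convex sets -/

/-- The nonzero cardinal numbers `n ≤ κ`. -/
def Level (κ : Cardinal.{u}) : Type u := Shrink.{u} (Set.Ioc (0 : Cardinal.{u}) κ)

/-- The cardinal number of a level. -/
def Level.card {κ : Cardinal.{u}} (n : Level κ) : Cardinal.{u} :=
  ((equivShrink (Set.Ioc (0 : Cardinal.{u}) κ)).symm n).1

/-- A fixed set of cardinality `n`. -/
def Level.Index {κ : Cardinal.{u}} (n : Level κ) : Type u := n.card.out

/-- The fixed Hilbert space `ℓ²(n)` of dimension `n`. -/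
def Hilb {κ : Cardinal.{u}} (n : Level κ) : Type u := lp (fun _ : n.Index => ℂ) 2

instance {κ : Cardinal.{u}} (n : Level κ) : NormedAddCommGroup (Hilb n) :=
  inferInstanceAs (NormedAddCommGroup (lp (fun _ : n.Index => ℂ) 2))

instance {κ : Cardinal.{u}} (n : Level κ) : InnerProductSpace ℂ (Hilb n) :=
  inferInstanceAs (InnerProductSpace ℂ (lp (fun _ : n.Index => ℂ) 2))

instance {κ : Cardinal.{u}} (n : Level κ) : CompleteSpace (Hilb n) :=
  inferInstanceAs (CompleteSpace (lp (fun _ : n.Index => ℂ) 2))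

/-- The map `φ` has completely bounded norm at most `C`. -/
def CBBound (V : OperatorSpace.{u}) {H : Type u} [NormedAddCommGroup H] [InnerProductSpace ℂ H]
    (φ : V.carrier →ₗ[ℂ] (H →L[ℂ] H)) (C : ℝ) : Prop :=
  ∀ k (a : Matrix (Fin k) (Fin k) V.carrier), ‖opMatrix (a.map φ)‖ ≤ C * V.mnorm k a

/-- The product `γ x δ` of an element `x` of `Mₙ(E) = CB(E_*, Mₙ)` with scalar matrices. -/
def sandwich {V : Type u} [AddCommGroup V] [Module ℂ V] {G H : Type u}
    [NormedAddCommGroup G] [InnerProductSpace ℂ G] [NormedAddCommGroup H] [InnerProductSpace ℂ H]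
    (γ : G →L[ℂ] H) (x : V →ₗ[ℂ] (G →L[ℂ] G)) (δ : H →L[ℂ] G) : V →ₗ[ℂ] (H →L[ℂ] H) where
  toFun v := γ ∘L x v ∘L δ
  map_add' v w := by ext; simp
  map_smul' c v := by ext; simp

open ContinuousLinearMap (adjoint)

/-- A compact nc convex set `K = ∐ₙ Kₙ` over the dual operator space `E = V*` with distinguished
predual `V`, where `n` ranges over the nonzero cardinals `n ≤ κ`. Here `Mₙ(E)` is the space of
completely bounded maps `V → B(Hₙ)` with the point-weak* topology. -/
structure CompactNCConvexSet (κ : Cardinal.{u}) : Type (u + 1) where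
  /-- The distinguished predual of the ambient dual operator space. -/
  predual : OperatorSpace.{u}
  points : ∀ n : Level κ, Set (predual.carrier →ₗ[ℂ] (Hilb n →L[ℂ] Hilb n))
  cb : ∀ n, ∀ x ∈ points n, ∃ C, CBBound predual x C
  sum_mem : ∀ (I : Type u) (lev : I → Level κ) (n : Level κ)
    (x : ∀ i, predual.carrier →ₗ[ℂ] (Hilb (lev i) →L[ℂ] Hilb (lev i)))
    (α : ∀ i, Hilb (lev i) →L[ℂ] Hilb n) (y : predual.carrier →ₗ[ℂ] (Hilb n →L[ℂ] Hilb n)),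
    (∀ i, x i ∈ points (lev i)) → (∃ C, ∀ i, CBBound predual (x i) C) →
    IsIsometryDecomposition α →
    PointWeakStarHasSum (fun i => sandwich (α i) (x i) (adjoint (α i))) y → y ∈ points n
  compress_mem : ∀ (m n : Level κ) (β : Hilb m →L[ℂ] Hilb n),
    adjoint β ∘L β = 1 → ∀ x ∈ points n, sandwich (adjoint β) x β ∈ points m
  isCompact : ∀ n, @IsCompact _ (pointWeakStar predual.carrier (Hilb n)) (points n)

namespace CompactNCConvexSet

variable {κ : Cardinal.{u}}

/-- The point-weak* topology on `Kₙ`. -/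
abbrev levelTopology (K : CompactNCConvexSet κ) (n : Level κ) : TopologicalSpace (K.points n) :=
  TopologicalSpace.induced Subtype.val (pointWeakStar K.predual.carrier (Hilb n))

/-- A continuous affine nc map between compact nc convex sets. -/
@[ext]
structure AffineMap (K L : CompactNCConvexSet κ) where
  toFun : ∀ n, K.points n → L.points n
  map_sum : ∀ (I : Type u) (lev : I → Level κ) (n : Level κ) (x : ∀ i, K.points (lev i))
    (α : ∀ i, Hilb (lev i) →L[ℂ] Hilb n) (y : K.points n),
    (∃ C, ∀ i, CBBound K.predual (x i).1 C) → IsIsometryDecomposition α →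
    PointWeakStarHasSum (fun i => sandwich (α i) (x i).1 (adjoint (α i))) y.1 →
    PointWeakStarHasSum (fun i => sandwich (α i) (toFun _ (x i)).1 (adjoint (α i))) (toFun n y).1
  map_compress : ∀ (m n : Level κ) (β : Hilb m →L[ℂ] Hilb n) (hβ : adjoint β ∘L β = 1)
    (x : K.points n), (toFun m ⟨_, K.compress_mem m n β hβ x.1 x.2⟩).1
      = sandwich (adjoint β) (toFun n x).1 β
  continuous_toFun : ∀ n, @Continuous _ _ (K.levelTopology n) (L.levelTopology n) (toFun n)

theorem pointWeakStarHasSum_sandwich_iff {V : Type u} [AddCommGroup V] [Module ℂ V]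
    {H : Type u} [NormedAddCommGroup H] [InnerProductSpace ℂ H] [CompleteSpace H]
    {I : Type u} {G : I → Type u} [∀ i, NormedAddCommGroup (G i)]
    [∀ i, InnerProductSpace ℂ (G i)] [∀ i, CompleteSpace (G i)]
    {α : ∀ i, G i →L[ℂ] H} (h : IsIsometryDecomposition α)
    {x : ∀ i, V →ₗ[ℂ] (G i →L[ℂ] G i)} {y : V →ₗ[ℂ] (H →L[ℂ] H)} :
    PointWeakStarHasSum (fun i => sandwich (α i) (x i) (adjoint (α i))) y ↔
      ∀ v i ζ, y v (α i ζ) = α i (x i v ζ) := by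
  rw [pointWeakStarHasSum_iff]
  exact forall_congr' fun v => h.hasSum_iff

theorem CBBound.of_hasSum {V : OperatorSpace.{u}}
    {H : Type u} [NormedAddCommGroup H] [InnerProductSpace ℂ H] [CompleteSpace H]
    {I : Type u} {G : I → Type u} [∀ i, NormedAddCommGroup (G i)]
    [∀ i, InnerProductSpace ℂ (G i)] [∀ i, CompleteSpace (G i)]
    {α : ∀ i, G i →L[ℂ] H} (h : IsIsometryDecomposition α)
    {x : ∀ i, V.carrier →ₗ[ℂ] (G i →L[ℂ] G i)} {y : V.carrier →ₗ[ℂ] (H →L[ℂ] H)}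
    (hy : PointWeakStarHasSum (fun i => sandwich (α i) (x i) (adjoint (α i))) y)
    {C : ℝ} (hC : CBBound V y C) (i : I) : CBBound V (x i) C := by
  rw [pointWeakStarHasSum_sandwich_iff h] at hy
  intro k a
  have h1 : a.map (x i) = (a.map y).map fun T => adjoint (α i) ∘L T ∘L α i := by
    ext p q ζ : 3
    simp [hy, isometry_adjoint_apply (h.1 i)]
  rw [h1]
  exact (norm_opMatrix_conj_le _ _ fun x => (isometry_norm (h.1 i) x).le).trans (hC k a)

namespace AffineMap

/-- The identity map. -/
protected def id (K : CompactNCConvexSet κ) : AffineMap K K where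
  toFun _ x := x
  map_sum _ _ _ _ _ _ _ _ h := h
  map_compress _ _ _ _ _ := rfl
  continuous_toFun _ := @continuous_id _ (_)

/-- Composition of continuous affine nc maps. -/
protected def comp {K L M : CompactNCConvexSet κ} (g : AffineMap L M) (f : AffineMap K L) :
    AffineMap K M where
  toFun n x := g.toFun n (f.toFun n x)
  map_sum I lev n x α y hb hα hy := by
    have h1 := f.map_sum I lev n x α y hb hα hy
    obtain ⟨C, hC⟩ := L.cb n _ (f.toFun n y).2
    exact g.map_sum I lev n _ α _ ⟨C, CBBound.of_hasSum hα h1 hC⟩ hα h1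
  map_compress m n β hβ x := by
    rw [← g.map_compress m n β hβ]
    congr 2
    exact Subtype.ext (f.map_compress m n β hβ x)
  continuous_toFun n := @Continuous.comp _ _ _ (_) (_) (_) _ _ (g.continuous_toFun n)
    (f.continuous_toFun n)

end AffineMap

/-- The category of compact nc convex sets and continuous affine nc maps. -/
instance : Category (CompactNCConvexSet κ) where
  Hom := AffineMap
  id := AffineMap.id
  comp f g := g.comp f

end CompactNCConvexSet

/-! ### The operator system of continuous affine nc functions -/

section Diagonal

variable {X : Type u} {G : X → Type u} [∀ x, NormedAddCommGroup (G x)]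
  [∀ x, InnerProductSpace ℂ (G x)]

theorem diag_single [DecidableEq X] {T : ∀ x, G x →L[ℂ] G x} {R : lp G 2 →L[ℂ] lp G 2}
    (h : ∀ f x, R f x = T x (f x)) (x : X) (ζ : G x) :
    R (lp.single 2 x ζ) = lp.single 2 x (T x ζ) := by
  ext y
  rw [h]
  by_cases hy : y = x
  · subst hy; simp
  · simp [hy]

theorem diag_compress [∀ x, CompleteSpace (G x)] [DecidableEq X] {T : ∀ x, G x →L[ℂ] G x}
    {R : lp G 2 →L[ℂ] lp G 2} (h : ∀ f x, R f x = T x (f x)) (x : X) :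
    adjoint (lp.singleContinuousLinearMap ℂ G 2 x) ∘L R ∘L lp.singleContinuousLinearMap ℂ G 2 x
      = T x := by
  ext ζ
  refine ext_inner_left ℂ fun η => ?_
  rw [ContinuousLinearMap.comp_apply, ContinuousLinearMap.adjoint_inner_right]
  simp [diag_single h, lp.inner_single_left]

theorem diag_opMatrix_isPositive_iff [∀ x, CompleteSpace (G x)] {ι : Type*} [Fintype ι]
    {T : ∀ x, Matrix ι ι (G x →L[ℂ] G x)} {R : Matrix ι ι (lp G 2 →L[ℂ] lp G 2)}
    (h : ∀ i j f x, R i j f x = T x i j (f x)) :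
    (opMatrix R).IsPositive ↔ ∀ x, (opMatrix (T x)).IsPositive := by
  classical
  constructor
  · intro hR x
    have h1 := opMatrix_conj_isPositive R (lp.singleContinuousLinearMap ℂ G 2 x) hR
    rwa [show (R.map fun T => adjoint (lp.singleContinuousLinearMap ℂ G 2 x) ∘L T ∘L
      lp.singleContinuousLinearMap ℂ G 2 x) = T x from
        Matrix.ext fun i j => diag_compress (T := fun x => T x i j) (h i j) x] at h1
  · intro hT
    rw [opMatrix_isPositive_iff]
    intro ξ
    have h1 : HasSum (fun x => ∑ i, ∑ j, ⟪ξ i x, T x i j (ξ j x)⟫_ℂ)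
        (∑ i, ∑ j, ⟪ξ i, R i j (ξ j)⟫_ℂ) := by
      refine hasSum_sum fun i _ => hasSum_sum fun j _ => ?_
      have := lp.hasSum_inner (𝕜 := ℂ) (ξ i) (R i j (ξ j))
      simpa only [h] using this
    exact h1.nonneg fun x => (opMatrix_isPositive_iff _).mp (hT x) fun i => ξ i x

theorem diag_opMatrix_norm_le [∀ x, CompleteSpace (G x)] {ι : Type*} [Fintype ι]
    {T : ∀ x, Matrix ι ι (G x →L[ℂ] G x)} {R : Matrix ι ι (lp G 2 →L[ℂ] lp G 2)}
    (h : ∀ i j f x, R i j f x = T x i j (f x)) (x : X) :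
    ‖opMatrix (T x)‖ ≤ ‖opMatrix R‖ := by
  classical
  have h1 := norm_opMatrix_conj_le R (lp.singleContinuousLinearMap ℂ G 2 x)
    (fun ζ => by simp [lp.norm_single])
  rwa [show (R.map fun T => adjoint (lp.singleContinuousLinearMap ℂ G 2 x) ∘L T ∘L
    lp.singleContinuousLinearMap ℂ G 2 x) = T x from
      Matrix.ext fun i j => diag_compress (T := fun x => T x i j) (h i j) x] at h1

theorem lp_hasSum_norm_sq {G : X → Type u} [∀ x, NormedAddCommGroup (G x)] (f : lp G 2) : HasSum (fun x => ‖f x‖ ^ 2) (‖f‖ ^ 2) := by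
  have := lp.hasSum_norm (p := 2) (by norm_num) f
  simpa using this

theorem diag_opMatrix_norm_eq [∀ x, CompleteSpace (G x)] {ι : Type*} [Fintype ι]
    {T : ∀ x, Matrix ι ι (G x →L[ℂ] G x)} {R : Matrix ι ι (lp G 2 →L[ℂ] lp G 2)}
    (h : ∀ i j f x, R i j f x = T x i j (f x)) :
    ⨆ x, ‖opMatrix (T x)‖ = ‖opMatrix R‖ := by
  have hb : BddAbove (Set.range fun x => ‖opMatrix (T x)‖) :=
    ⟨_, by rintro _ ⟨x, rfl⟩; exact diag_opMatrix_norm_le h x⟩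
  refine le_antisymm (Real.iSup_le (diag_opMatrix_norm_le h) (norm_nonneg _)) ?_
  set C := ⨆ x, ‖opMatrix (T x)‖
  have hC : 0 ≤ C := Real.iSup_nonneg fun _ => norm_nonneg _
  refine ContinuousLinearMap.opNorm_le_bound _ hC fun ξ => ?_
  have h1 : ∀ ζ : PiLp 2 (fun _ : ι => lp G 2),
      HasSum (fun x => ‖(WithLp.toLp 2 (fun i => ζ i x) : PiLp 2 (fun _ : ι => G x))‖ ^ 2)
        (‖ζ‖ ^ 2) := by
    intro ζ
    simp_rw [PiLp.norm_sq_eq_of_L2]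
    exact hasSum_sum fun i _ => lp_hasSum_norm_sq (ζ i)
  have h2 : ∀ x, (WithLp.toLp 2 (fun i => opMatrix R ξ i x) : PiLp 2 (fun _ : ι => G x))
      = opMatrix (T x) (WithLp.toLp 2 (fun i => ξ i x)) := by
    intro x
    ext i
    simp only [opMatrix_apply, ← h, lp.coeFn_sum]
    exact Finset.sum_apply x Finset.univ _
  have h3 := hasSum_le (fun x => ?_) (h1 (opMatrix R ξ)) ((h1 ξ).mul_left (C ^ 2))
  · rw [← mul_pow] at h3
    exact (pow_le_pow_iff_left₀ (norm_nonneg _) (by positivity) two_ne_zero).mp h3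
  · rw [h2, ← mul_pow]
    gcongr
    exact (ContinuousLinearMap.le_opNorm _ _).trans (by gcongr; exact le_ciSup hb x)

/-- The direct sum of a pointwise bounded family of linear maps into `B(Gₓ)`. -/
def diagRep {A : Type u} [AddCommGroup A] [Module ℂ A] (ev : ∀ x, A →ₗ[ℂ] (G x →L[ℂ] G x))
    (hb : ∀ a, ∃ C, 0 ≤ C ∧ ∀ x, ‖ev x a‖ ≤ C) : A →ₗ[ℂ] (lp G 2 →L[ℂ] lp G 2) where
  toFun a := lp.mapCLM 2 (fun x => ev x a) (hb a).choose_spec.1 (hb a).choose_spec.2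
  map_add' a b := by ext f x; simp
  map_smul' c a := by ext f x; simp

theorem diagRep_apply {A : Type u} [AddCommGroup A] [Module ℂ A]
    (ev : ∀ x, A →ₗ[ℂ] (G x →L[ℂ] G x)) (hb : ∀ a, ∃ C, 0 ≤ C ∧ ∀ x, ‖ev x a‖ ≤ C)
    (a : A) (f : lp G 2) (x : X) : diagRep ev hb a f x = ev x a (f x) := by
  simp [diagRep]

theorem norm_adjoint_comp_comp_le {H G : Type u} [NormedAddCommGroup H] [InnerProductSpace ℂ H]
    [CompleteSpace H] [NormedAddCommGroup G] [InnerProductSpace ℂ G] [CompleteSpace G]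
    (J : G →L[ℂ] H) (hJ : ∀ x, ‖J x‖ = ‖x‖) {T : H →L[ℂ] H} {ε : ℝ} (hT : ‖T‖ ≤ ε) :
    ‖adjoint J ∘L T ∘L J‖ ≤ ε := by
  have hJ1 : ‖J‖ ≤ 1 := J.opNorm_le_bound zero_le_one fun ζ => by rw [hJ, one_mul]
  have hJ2 : ‖adjoint J‖ ≤ 1 := by rwa [LinearIsometryEquiv.norm_map]
  calc _ ≤ ‖adjoint J‖ * (‖T‖ * ‖J‖) :=
          (ContinuousLinearMap.opNorm_comp_le _ _).trans
            (by gcongr; exact ContinuousLinearMap.opNorm_comp_le _ _)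
      _ ≤ 1 * (ε * 1) := by gcongr; exact (norm_nonneg _).trans hT
      _ = ε := by ring

theorem isClosed_range_diagRep [∀ x, CompleteSpace (G x)] {A : Type u} [AddCommGroup A]
    [Module ℂ A] (ev : ∀ x, A →ₗ[ℂ] (G x →L[ℂ] G x))
    (hb : ∀ a, ∃ C, 0 ≤ C ∧ ∀ x, ‖ev x a‖ ≤ C)
    (hc : ∀ T : ∀ x, G x →L[ℂ] G x, (∀ ε > 0, ∃ a, ∀ x, ‖T x - ev x a‖ ≤ ε) →
      ∃ a, ∀ x, ev x a = T x) : IsClosed (Set.range (diagRep ev hb)) := by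
  classical
  refine isClosed_of_closure_subset fun T hT => ?_
  rw [Metric.mem_closure_iff] at hT
  have happ : ∀ ε > 0, ∃ b : A, ‖T - diagRep ev hb b‖ ≤ ε ∧
      ∀ x, ‖adjoint (lp.singleContinuousLinearMap ℂ G 2 x) ∘L T ∘L
        lp.singleContinuousLinearMap ℂ G 2 x - ev x b‖ ≤ ε := by
    intro ε hε
    obtain ⟨_, ⟨b, rfl⟩, hb'⟩ := hT ε hε
    rw [dist_eq_norm] at hb'
    refine ⟨b, hb'.le, fun x => ?_⟩
    rw [← diag_compress (T := fun x => ev x b) (diagRep_apply ev hb b) x]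
    have h1 := norm_adjoint_comp_comp_le (lp.singleContinuousLinearMap ℂ G 2 x)
      (fun ζ => by simp [lp.norm_single]) hb'.le
    simpa only [ContinuousLinearMap.sub_comp, ContinuousLinearMap.comp_sub] using h1
  obtain ⟨a, ha⟩ := hc _ fun ε hε => (happ ε hε).imp fun b h => h.2
  refine ⟨a, ?_⟩
  rw [← sub_eq_zero, ← norm_le_zero_iff]
  refine le_of_forall_pos_le_add fun ε hε => ?_
  obtain ⟨b, hb1, hb2⟩ := happ (ε / 2) (by positivity)
  simp_rw [← ha, ← map_sub] at hb2
  have h1 : ‖diagRep ev hb (a - b)‖ ≤ ε / 2 := by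
    refine ContinuousLinearMap.opNorm_le_bound _ (by positivity) fun f => ?_
    refine (pow_le_pow_iff_left₀ (norm_nonneg _) (by positivity) two_ne_zero).mp ?_
    rw [mul_pow]
    refine hasSum_le (fun x => ?_) (lp_hasSum_norm_sq _) ((lp_hasSum_norm_sq f).mul_left _)
    rw [diagRep_apply, ← mul_pow]
    gcongr
    exact ContinuousLinearMap.le_of_opNorm_le _ (hb2 x) _
  have h2 : diagRep ev hb a - T = diagRep ev hb (a - b) - (T - diagRep ev hb b) := by
    rw [map_sub]; abel
  rw [h2]
  refine (norm_sub_le _ _).trans ?_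
  linarith

theorem diagRep_injective [∀ x, CompleteSpace (G x)] {A : Type u} [AddCommGroup A]
    [Module ℂ A] (ev : ∀ x, A →ₗ[ℂ] (G x →L[ℂ] G x))
    (hb : ∀ a, ∃ C, 0 ≤ C ∧ ∀ x, ‖ev x a‖ ≤ C)
    (h : ∀ a b, (∀ x, ev x a = ev x b) → a = b) : Function.Injective (diagRep ev hb) := by
  classical
  intro a b hab
  refine h a b fun x => ?_
  have h1 := diag_compress (T := fun x => ev x a) (diagRep_apply ev hb a) x
  have h2 := diag_compress (T := fun x => ev x b) (diagRep_apply ev hb b) x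
  rw [hab] at h1
  exact h1.symm.trans h2

theorem diagRep_one {A : Type u} [AddCommGroup A]
    [Module ℂ A] (ev : ∀ x, A →ₗ[ℂ] (G x →L[ℂ] G x))
    (hb : ∀ a, ∃ C, 0 ≤ C ∧ ∀ x, ‖ev x a‖ ≤ C) {a : A} (h : ∀ x, ev x a = 1) :
    diagRep ev hb a = 1 := by
  ext f x
  rw [diagRep_apply, h]
  rfl

theorem diagRep_adjoint [∀ x, CompleteSpace (G x)] {A : Type u} [AddCommGroup A]
    [Module ℂ A] (ev : ∀ x, A →ₗ[ℂ] (G x →L[ℂ] G x))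
    (hb : ∀ a, ∃ C, 0 ≤ C ∧ ∀ x, ‖ev x a‖ ≤ C) {a b : A} (h : ∀ x, ev x b = adjoint (ev x a)) :
    diagRep ev hb b = adjoint (diagRep ev hb a) := by
  rw [ContinuousLinearMap.eq_adjoint_iff]
  intro f g
  rw [lp.inner_eq_tsum, lp.inner_eq_tsum]
  refine tsum_congr fun x => ?_
  rw [diagRep_apply, diagRep_apply, h]
  exact ContinuousLinearMap.adjoint_inner_left _ _ _

end Diagonal

namespace CompactNCConvexSet

variable {κ : Cardinal.{u}}

instance (K : CompactNCConvexSet κ) (n : Level κ) : TopologicalSpace (K.points n) :=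
  K.levelTopology n

/-- The graded map `a : K → M = ∐ₙ Mₙ` respects direct sums. -/
def RespectsSums (K : CompactNCConvexSet κ)
    (a : ∀ n : Level κ, K.points n → (Hilb n →L[ℂ] Hilb n)) : Prop :=
  ∀ (I : Type u) (lev : I → Level κ) (n : Level κ) (x : ∀ i, K.points (lev i))
    (α : ∀ i, Hilb (lev i) →L[ℂ] Hilb n) (y : K.points n),
    (∃ C, ∀ i, CBBound K.predual (x i).1 C) → IsIsometryDecomposition α →
    PointWeakStarHasSum (fun i => sandwich (α i) (x i).1 (adjoint (α i))) y.1 →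
    WeakStarHasSum (fun i => α i ∘L a _ (x i) ∘L adjoint (α i)) (a n y)

/-- The graded map `a : K → M = ∐ₙ Mₙ` is equivariant with respect to isometries. -/
def IsEquivariant (K : CompactNCConvexSet κ)
    (a : ∀ n : Level κ, K.points n → (Hilb n →L[ℂ] Hilb n)) : Prop :=
  ∀ (m n : Level κ) (β : Hilb m →L[ℂ] Hilb n) (hβ : adjoint β ∘L β = 1) (x : K.points n),
    a m ⟨_, K.compress_mem m n β hβ x.1 x.2⟩ = adjoint β ∘L a n x ∘L β

/-- Continuous affine nc functions on `K`: graded maps into `M = ∐ₙ Mₙ` which respect direct sums,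
are equivariant with respect to isometries, and are continuous on every level. -/
structure IsContAffine (K : CompactNCConvexSet κ)
    (a : ∀ n : Level κ, K.points n → (Hilb n →L[ℂ] Hilb n)) : Prop where
  map_sum : K.RespectsSums a
  map_compress : K.IsEquivariant a
  continuous_toFun : ∀ n, @Continuous _ _ (K.levelTopology n) (weakStar (Hilb n)) (a n)

theorem pairing_adjoint {H : Type u} [NormedAddCommGroup H] [InnerProductSpace ℂ H]
    [CompleteSpace H] (p : lp (fun _ : ℕ => H) 2 × lp (fun _ : ℕ => H) 2) (T : H →L[ℂ] H) :
    pairing p (adjoint T) = star (pairing (p.2, p.1) T) := by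
  unfold pairing
  rw [tsum_star]
  refine tsum_congr fun k => ?_
  rw [ContinuousLinearMap.adjoint_inner_right, Complex.star_def, inner_conj_symm]

variable (K : CompactNCConvexSet κ)

/-- The space `A(K)` of continuous affine nc functions on `K`. -/
def affineSubmodule :
    Submodule ℂ (∀ n : Level κ, K.points n → (Hilb n →L[ℂ] Hilb n)) where
  carrier := {a | K.IsContAffine a}
  zero_mem' :=
    { map_sum := fun I lev n x α y _ hα _ => hα.hasSum_iff.mpr (by simp)
      map_compress := fun m n β hβ x => by ext; simp
      continuous_toFun := fun n => continuous_weakStar.mpr fun p => by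
        simpa [pairing] using @continuous_const _ _ (_) _ _ }
  add_mem' {a b} ha hb :=
    { map_sum := fun I lev n x α y h1 hα h2 => hα.hasSum_iff.mpr fun i ζ => by
        have h3 := hα.hasSum_iff.mp (ha.map_sum I lev n x α y h1 hα h2) i ζ
        have h4 := hα.hasSum_iff.mp (hb.map_sum I lev n x α y h1 hα h2) i ζ
        simp [h3, h4]
      map_compress := fun m n β hβ x => by
        have h3 := ha.map_compress m n β hβ x
        have h4 := hb.map_compress m n β hβ x
        ext; simp [h3, h4]
      continuous_toFun := fun n => continuous_weakStar.mpr fun p => by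
        have h3 := continuous_weakStar.mp (ha.continuous_toFun n) p
        have h4 := continuous_weakStar.mp (hb.continuous_toFun n) p
        have h5 : ∀ x, pairing p ((a + b) n x) = pairing p (a n x) + pairing p (b n x) :=
          fun x => map_add (pairingₗ p) _ _
        simp_rw [h5]
        exact @Continuous.add _ _ _ _ _ (_) _ _ h3 h4 }
  smul_mem' c a ha :=
    { map_sum := fun I lev n x α y h1 hα h2 => hα.hasSum_iff.mpr fun i ζ => by
        have h3 := hα.hasSum_iff.mp (ha.map_sum I lev n x α y h1 hα h2) i ζ
        simp [h3]
      map_compress := fun m n β hβ x => by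
        have h3 := ha.map_compress m n β hβ x
        ext; simp [h3]
      continuous_toFun := fun n => continuous_weakStar.mpr fun p => by
        have h3 := continuous_weakStar.mp (ha.continuous_toFun n) p
        have h5 : ∀ x, pairing p ((c • a) n x) = c • pairing p (a n x) :=
          fun x => map_smul (pairingₗ p) _ _
        simp_rw [h5]
        exact @Continuous.const_smul _ _ _ _ _ _ (_) _ h3 c }

theorem IsContAffine.one : K.IsContAffine fun _ _ => 1 where
  map_sum I lev n x α y _ hα _ := hα.hasSum_iff.mpr (by simp)
  map_compress m n β hβ x := hβ.symm
  continuous_toFun n := @continuous_const _ _ (_) (_) _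

variable {K}

theorem IsContAffine.adjoint {a : ∀ n : Level κ, K.points n → (Hilb n →L[ℂ] Hilb n)}
    (ha : K.IsContAffine a) : K.IsContAffine fun n x => ContinuousLinearMap.adjoint (a n x) where
  map_sum I lev n x α y h1 hα h2 := by
    have h3 := ha.map_sum I lev n x α y h1 hα h2
    rw [weakStarHasSum_iff] at *
    intro p
    have h4 := (h3 (p.2, p.1)).star
    rw [pairing_adjoint]
    have h5 : ∀ i, α i ∘L ContinuousLinearMap.adjoint (a _ (x i)) ∘L
        ContinuousLinearMap.adjoint (α i) = ContinuousLinearMap.adjoint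
          (α i ∘L a _ (x i) ∘L ContinuousLinearMap.adjoint (α i)) := by
      intro i
      simp [ContinuousLinearMap.adjoint_comp, ContinuousLinearMap.comp_assoc]
    simp_rw [h5, pairing_adjoint]
    exact h4
  map_compress m n β hβ x := by
    have h1 := ha.map_compress m n β hβ x
    beta_reduce
    rw [h1]
    simp [ContinuousLinearMap.adjoint_comp, ContinuousLinearMap.comp_assoc]
  continuous_toFun n := continuous_weakStar.mpr fun p => by
    simp_rw [pairing_adjoint]
    exact @Continuous.star _ _ _ _ _ (_) _ (continuous_weakStar.mp (ha.continuous_toFun n) _)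

/-- Uniform limits of continuous affine nc functions are continuous affine nc functions. -/
theorem IsContAffine.of_uniform {a : ∀ n : Level κ, K.points n → (Hilb n →L[ℂ] Hilb n)}
    (h : ∀ ε > 0, ∃ b, K.IsContAffine b ∧ ∀ n x, ‖a n x - b n x‖ ≤ ε) : K.IsContAffine a where
  map_sum I lev n x α y h1 hα h2 := hα.hasSum_iff.mpr fun i ζ => by
    rw [← sub_eq_zero, ← norm_le_zero_iff]
    refine le_of_forall_pos_le_add fun ε hε => ?_
    obtain ⟨b, hb, hab⟩ := h (ε / (2 * (‖ζ‖ + 1))) (by positivity)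
    have h3 := hα.hasSum_iff.mp (hb.map_sum I lev n x α y h1 hα h2) i ζ
    have h4 : a n y (α i ζ) - α i (a _ (x i) ζ)
        = (a n y - b n y) (α i ζ) - α i ((a _ (x i) - b _ (x i)) ζ) := by
      simp [h3]
    have h5 := (a n y - b n y).le_of_opNorm_le (hab n y) (α i ζ)
    have h6 := (a _ (x i) - b _ (x i)).le_of_opNorm_le (hab _ (x i)) ζ
    rw [isometry_norm (hα.1 i)] at h5
    have h7 : ε / (2 * (‖ζ‖ + 1)) * ‖ζ‖ ≤ ε / 2 := by
      rw [div_mul_eq_mul_div, div_le_div_iff₀ (by positivity) (by positivity)]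
      nlinarith [norm_nonneg ζ]
    rw [h4]
    refine (norm_sub_le _ _).trans ?_
    rw [isometry_norm (hα.1 i)]
    linarith
  map_compress m n β hβ x := by
    rw [← sub_eq_zero, ← norm_le_zero_iff]
    refine le_of_forall_pos_le_add fun ε hε => ?_
    obtain ⟨b, hb, hab⟩ := h (ε / 2) (by positivity)
    have h3 := hb.map_compress m n β hβ x
    set z : K.points m := ⟨_, K.compress_mem m n β hβ x.1 x.2⟩
    have h4 : a m z - ContinuousLinearMap.adjoint β ∘L a n x ∘L β
        = (a m z - b m z) - ContinuousLinearMap.adjoint β ∘L (a n x - b n x) ∘L β := by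
      rw [h3]; ext; simp
    have h5 : ‖ContinuousLinearMap.adjoint β ∘L (a n x - b n x) ∘L β‖ ≤ ε / 2 := by
      have hβ1 : ‖β‖ ≤ 1 := β.opNorm_le_bound zero_le_one fun ζ => by
        rw [isometry_norm hβ, one_mul]
      have hβ2 : ‖ContinuousLinearMap.adjoint β‖ ≤ 1 := by
        rwa [LinearIsometryEquiv.norm_map]
      calc _ ≤ ‖ContinuousLinearMap.adjoint β‖ * (‖a n x - b n x‖ * ‖β‖) :=
            (ContinuousLinearMap.opNorm_comp_le _ _).trans
              (by gcongr; exact ContinuousLinearMap.opNorm_comp_le _ _)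
        _ ≤ 1 * (ε / 2 * 1) := by gcongr; exact hab n x
        _ = ε / 2 := by ring
    rw [h4]
    refine (norm_sub_le _ _).trans ?_
    linarith [hab m z]
  continuous_toFun n := continuous_weakStar.mpr fun p => by
    refine continuous_of_uniform_approx_of_continuous fun s hs => ?_
    obtain ⟨ε, hε, hs⟩ := Metric.mem_uniformity_dist.mp hs
    have hM : 0 ≤ ∑' k, ‖p.2 k‖ * ‖p.1 k‖ := tsum_nonneg fun k => by positivity
    set M := ∑' k, ‖p.2 k‖ * ‖p.1 k‖
    obtain ⟨b, hb, hab⟩ := h (ε / (2 * (M + 1))) (by positivity)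
    refine ⟨fun x => pairing p (b n x), continuous_weakStar.mp (hb.continuous_toFun n) p, ?_⟩
    intro x
    refine hs ?_
    have h1 : pairing p (a n x) - pairing p (b n x) = pairing p (a n x - b n x) :=
      (map_sub (pairingₗ p) _ _).symm
    rw [dist_eq_norm, h1]
    refine (norm_pairing_le p (hab n x)).trans_lt ?_
    rw [div_mul_eq_mul_div, div_lt_iff₀ (by positivity)]
    nlinarith

theorem _root_.NCConvex.opNorm_le_of_numericalRadius {H : Type u} [NormedAddCommGroup H]
    [InnerProductSpace ℂ H] (T : H →L[ℂ] H) {C : ℝ} (hC : 0 ≤ C)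
    (h : ∀ ξ, ‖⟪ξ, T ξ⟫_ℂ‖ ≤ C * ‖ξ‖ ^ 2) : ‖T‖ ≤ 4 * C := by
  have h' : ∀ ξ, ‖⟪T ξ, ξ⟫_ℂ‖ ≤ C * ‖ξ‖ ^ 2 := fun ξ => by rw [norm_inner_symm]; exact h ξ
  have h1 : ∀ x y : H, ‖x‖ = 1 → ‖y‖ = 1 → ‖⟪T y, x⟫_ℂ‖ ≤ 4 * C := by
    intro x y hx hy
    have key : ∀ z : H, ‖z‖ ≤ 2 → ‖⟪T z, z⟫_ℂ‖ ≤ C * 4 := fun z hz => (h' z).trans (by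
      gcongr
      nlinarith [norm_nonneg z])
    have e1 := key (x + y) ((norm_add_le _ _).trans (by linarith))
    have e2 := key (x - y) ((norm_sub_le _ _).trans (by linarith))
    have e3 := key (x + Complex.I • y) ((norm_add_le _ _).trans (by simp [norm_smul]; linarith))
    have e4 := key (x - Complex.I • y) ((norm_sub_le _ _).trans (by simp [norm_smul]; linarith))
    have h2 := inner_map_polarization (T : H →ₗ[ℂ] H) x y
    simp only [ContinuousLinearMap.coe_coe] at h2
    rw [h2, norm_div]
    have h3 : ‖(4 : ℂ)‖ = 4 := by simp
    rw [h3, div_le_iff₀ (by norm_num)]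
    refine (norm_sub_le _ _).trans ?_
    refine (add_le_add (norm_add_le _ _) le_rfl).trans ?_
    rw [norm_mul, norm_mul, Complex.norm_I, one_mul, one_mul]
    have h4 := norm_sub_le ⟪T (x + y), x + y⟫_ℂ ⟪T (x - y), x - y⟫_ℂ
    linarith
  refine opNorm_le_of_inner T (by positivity) fun x y => ?_
  by_cases hx : x = 0
  · simp [hx]
  by_cases hy : y = 0
  · simp [hy]
  have hx' : 0 < ‖x‖ := norm_pos_iff.mpr hx
  have hy' : 0 < ‖y‖ := norm_pos_iff.mpr hy
  have h2 := h1 (((‖y‖⁻¹ : ℝ) : ℂ) • y) (((‖x‖⁻¹ : ℝ) : ℂ) • x)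
    (by rw [norm_smul]; simp [hy'.ne']) (by rw [norm_smul]; simp [hx'.ne'])
  rw [map_smul, inner_smul_left, inner_smul_right, norm_mul, norm_mul, norm_inner_symm] at h2
  simp only [RCLike.norm_conj, Complex.norm_real, norm_inv, norm_norm] at h2
  rw [← mul_assoc, ← mul_inv, inv_mul_le_iff₀ (by positivity)] at h2
  linarith

/-- The level `1`. -/
def _root_.NCConvex.Level.one (h : 1 ≤ κ) : Level κ :=
  equivShrink (Set.Ioc (0 : Cardinal.{u}) κ) ⟨1, zero_lt_one, h⟩

theorem _root_.NCConvex.Level.one_le (n : Level κ) : 1 ≤ κ := by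
  have h1 := ((equivShrink (Set.Ioc (0 : Cardinal.{u}) κ)).symm n).2
  exact Cardinal.one_le_iff_pos.mpr (h1.1.trans_le h1.2)

theorem _root_.NCConvex.exists_isometry_lp (ι : Type u) [Unique ι] :
    ∃ e : lp (fun _ : ι => ℂ) 2, ∀ (G : Type u) [NormedAddCommGroup G] [InnerProductSpace ℂ G]
      [CompleteSpace G] (ξ : G), ‖ξ‖ = 1 → ∃ β : lp (fun _ : ι => ℂ) 2 →L[ℂ] G,
        ContinuousLinearMap.adjoint β ∘L β = 1 ∧ β e = ξ := by
  classical
  refine ⟨lp.single 2 default 1, fun G _ _ _ ξ hξ => ?_⟩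
  refine ⟨(lp.evalCLM ℂ (fun _ : ι => ℂ) 2 default).smulRight ξ, ?_, ?_⟩
  · refine (ContinuousLinearMap.norm_map_iff_adjoint_comp_self
      ((lp.evalCLM ℂ (fun _ : ι => ℂ) 2 default).smulRight ξ)).mp fun f => ?_
    have hf : f = lp.single 2 default (f default) := by
      ext j
      obtain rfl := Subsingleton.elim default j
      simp
    rw [ContinuousLinearMap.smulRight_apply, norm_smul, hξ, mul_one]
    conv_rhs => rw [hf, lp.norm_single (by norm_num)]
    rfl
  · rw [ContinuousLinearMap.smulRight_apply]
    have : lp.evalCLM ℂ (fun _ : ι => ℂ) 2 default (lp.single 2 default 1) = 1 := by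
      change (lp.single 2 default (1 : ℂ) : lp (fun _ : ι => ℂ) 2) default = 1
      simp
    rw [this, one_smul]

theorem _root_.NCConvex.Level.exists_isometry (h : 1 ≤ κ) :
    ∃ e : Hilb (Level.one h), ∀ (n : Level κ) (ξ : Hilb n), ‖ξ‖ = 1 →
      ∃ β : Hilb (Level.one h) →L[ℂ] Hilb n, ContinuousLinearMap.adjoint β ∘L β = 1 ∧ β e = ξ := by
  have h1 : (Level.one h).card = 1 := by simp [Level.one, Level.card]
  have h2 : Cardinal.mk (Level.one h).Index = 1 := by rw [Level.Index, Cardinal.mk_out, h1]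
  obtain ⟨hs, ⟨i⟩⟩ := Cardinal.eq_one_iff_unique.mp h2
  let _ : Unique (Level.one h).Index := ⟨⟨i⟩, fun j => Subsingleton.elim _ _⟩
  obtain ⟨e, he⟩ := exists_isometry_lp (Level.one h).Index
  exact ⟨e, fun n ξ hξ => he (Hilb n) ξ hξ⟩

/-- Continuous affine nc functions on a compact nc convex set are bounded. -/
theorem IsContAffine.bounded {a : ∀ n : Level κ, K.points n → (Hilb n →L[ℂ] Hilb n)}
    (ha : K.IsContAffine a) : ∃ C, 0 ≤ C ∧ ∀ n x, ‖a n x‖ ≤ C := by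
  by_cases h1 : 1 ≤ κ
  swap
  · exact ⟨0, le_rfl, fun n => absurd n.one_le h1⟩
  obtain ⟨e, he⟩ := Level.exists_isometry h1
  have h2 := continuous_weakStar.mp (ha.continuous_toFun (Level.one h1)) (vecPair e e)
  have h3 : ∃ C, ∀ x, ‖⟪e, a (Level.one h1) x e⟫_ℂ‖ ≤ C := by
    let _ := pointWeakStar K.predual.carrier (Hilb (Level.one h1))
    have hc : CompactSpace (K.points (Level.one h1)) :=
      isCompact_iff_compactSpace.mp (K.isCompact (Level.one h1))
    simp_rw [pairing_vecPair] at h2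
    obtain ⟨C, hC⟩ := (isCompact_range h2).isBounded.exists_norm_le
    exact ⟨C, fun x => hC _ ⟨x, rfl⟩⟩
  obtain ⟨C, hC⟩ := h3
  refine ⟨4 * max C 0, by positivity, fun n x => ?_⟩
  refine opNorm_le_of_numericalRadius _ (le_max_right _ _) fun ξ => ?_
  by_cases hξ : ξ = 0
  · simp [hξ]
  have hξ' : 0 < ‖ξ‖ := norm_pos_iff.mpr hξ
  obtain ⟨β, hβ, hβe⟩ := he n (((‖ξ‖⁻¹ : ℝ) : ℂ) • ξ) (by rw [norm_smul]; simp [hξ'.ne'])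
  have h4 := hC ⟨_, K.compress_mem _ n β hβ x.1 x.2⟩
  rw [ha.map_compress _ n β hβ x, ContinuousLinearMap.comp_apply, ContinuousLinearMap.comp_apply,
    ContinuousLinearMap.adjoint_inner_right, hβe, map_smul, inner_smul_left, inner_smul_right,
    norm_mul, norm_mul] at h4
  simp only [RCLike.norm_conj, Complex.norm_real, norm_inv, norm_norm] at h4
  rw [← mul_assoc, ← mul_inv, inv_mul_le_iff₀ (by positivity)] at h4
  calc _ ≤ _ := h4
    _ ≤ _ := by rw [mul_comm, sq]; gcongr; exact le_max_left _ _

variable (K)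

instance : StarAddMonoid K.affineSubmodule where
  star a := ⟨fun n x => adjoint (a.1 n x), a.2.adjoint⟩
  star_involutive a := by
    ext n x : 3
    exact ContinuousLinearMap.adjoint_adjoint _
  star_add a b := by
    ext n x : 3
    exact map_add _ _ _

instance : StarModule ℂ K.affineSubmodule where
  star_smul c a := by
    ext n x : 3
    exact map_smulₛₗ (adjoint : (Hilb n →L[ℂ] Hilb n) ≃ₗᵢ⋆[ℂ] (Hilb n →L[ℂ] Hilb n)) c (a.1 n x)

/-- The constant function with value `1`. -/
instance : One K.affineSubmodule where
  one := ⟨fun _ _ => 1, IsContAffine.one K⟩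

/-- Evaluation at a point of `K`. -/
def evalAt (n : Level κ) (x : K.points n) : K.affineSubmodule →ₗ[ℂ] (Hilb n →L[ℂ] Hilb n) where
  toFun a := a.1 n x
  map_add' _ _ := rfl
  map_smul' _ _ := rfl

/-- The operator system `A(K)` of continuous affine nc functions on `K`, with the pointwise
adjoint, the pointwise matrix order, the constant function `1` as unit, and the uniform matrix
norms. -/
def affineSystem : OperatorSystem.{u} where
  carrier := K.affineSubmodule
  cone k := {a | ∀ n x, (opMatrix (a.map (K.evalAt n x))).IsPositive}
  mnorm k a := ⨆ x : Σ n, K.points n, ‖opMatrix (a.map (K.evalAt x.1 x.2))‖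
  exists_rep := by
    have hb : ∀ a : K.affineSubmodule, ∃ C, 0 ≤ C ∧
        ∀ x : Σ n, K.points n, ‖K.evalAt x.1 x.2 a‖ ≤ C := fun a => by
      obtain ⟨C, hC, h⟩ := a.2.bounded
      exact ⟨C, hC, fun x => h x.1 x.2⟩
    refine ⟨lp (fun x : Σ n, K.points n => Hilb x.1) 2, inferInstance, inferInstance,
      inferInstance, diagRep (fun x : Σ n, K.points n => K.evalAt x.1 x.2) hb,
      diagRep_injective _ _ ?_, isClosed_range_diagRep _ _ ?_, diagRep_one _ _ fun x => rfl,
      fun a => diagRep_adjoint _ _ fun x => rfl, fun k a => ?_, fun k a => ?_⟩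
    · intro a b h
      ext n x : 3
      exact h ⟨n, x⟩
    · intro T hT
      refine ⟨⟨fun n x => T ⟨n, x⟩, IsContAffine.of_uniform fun ε hε => ?_⟩, fun x => rfl⟩
      obtain ⟨b, hb⟩ := hT ε hε
      exact ⟨b.1, b.2, fun n x => hb ⟨n, x⟩⟩
    · refine Iff.trans ?_ (diag_opMatrix_isPositive_iff
        (T := fun x : Σ n, K.points n => a.map (K.evalAt x.1 x.2))
        fun i j f x => diagRep_apply _ hb _ _ _).symm
      exact ⟨fun h x => h x.1 x.2, fun h n x => h ⟨n, x⟩⟩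
    · exact diag_opMatrix_norm_eq fun i j f x => diagRep_apply _ hb _ _ _

/-- The unital completely positive map `A(θ) : A(L) → A(K)`, `A(θ)(b)(x) = b(θ(x))`, of a
continuous affine nc map `θ : K → L`. -/
def affineSystemMap {K L : CompactNCConvexSet κ} (θ : AffineMap K L) :
    UCPMap L.affineSystem K.affineSystem where
  toLinearMap := show L.affineSubmodule →ₗ[ℂ] K.affineSubmodule from
    { toFun := fun b => ⟨fun n x => b.1 n (θ.toFun n x),
        { map_sum := fun I lev n x α y hb hα hy => by
            have h1 := θ.map_sum I lev n x α y hb hα hy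
            obtain ⟨C, hC⟩ := L.cb n _ (θ.toFun n y).2
            exact b.2.map_sum I lev n _ α _ ⟨C, CBBound.of_hasSum hα h1 hC⟩ hα h1
          map_compress := fun m n β hβ x => by
            rw [← b.2.map_compress m n β hβ]
            exact congrArg (b.1 m) (Subtype.ext (θ.map_compress m n β hβ x))
          continuous_toFun := fun n => @Continuous.comp _ _ _ (_) (_) (_) _ _
            (b.2.continuous_toFun n) (θ.continuous_toFun n) }⟩
      map_add' := fun _ _ => rfl
      map_smul' := fun _ _ => rfl }
  map_one := rfl
  map_cone k a ha := fun n x => by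
    have h : ∀ n x, (opMatrix (a.map (L.evalAt n x))).IsPositive := ha
    exact h n (θ.toFun n x)

end CompactNCConvexSet

/-- The contravariant functor `A` from compact nc convex sets to closed operator systems. -/
def affineFunctor (κ : Cardinal.{u}) : (CompactNCConvexSet κ)ᵒᵖ ⥤ OperatorSystem.{u} where
  obj K := K.unop.affineSystem
  map θ := CompactNCConvexSet.affineSystemMap θ.unop
  map_id _ := rfl
  map_comp _ _ := rfl

/-! ### The nc state space of an operator system -/

/-- Unital completely positive maps from an operator system into `B(H)`. -/
def IsUCP (S : OperatorSystem.{u}) {H : Type u} [NormedAddCommGroup H] [InnerProductSpace ℂ H]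
    (φ : S.carrier →ₗ[ℂ] (H →L[ℂ] H)) : Prop :=
  φ 1 = 1 ∧ ∀ k (a : Matrix (Fin k) (Fin k) S.carrier), a ∈ S.cone k →
    (opMatrix (a.map φ)).IsPositive

section UCP

variable {S : OperatorSystem.{u}} {H : Type u} [NormedAddCommGroup H] [InnerProductSpace ℂ H]

theorem OperatorSystem.mnorm_nonneg (S : OperatorSystem.{u}) {k : ℕ}
    (a : Matrix (Fin k) (Fin k) S.carrier) : 0 ≤ S.mnorm k a := by
  obtain ⟨H, _, _, _, ι, -, -, -, -, -, h⟩ := S.exists_rep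
  rw [h]
  exact norm_nonneg _

/-- Unital completely positive maps are completely contractive. -/
theorem IsUCP.norm_le {φ : S.carrier →ₗ[ℂ] (H →L[ℂ] H)} (hφ : IsUCP S φ) {k : ℕ}
    (a : Matrix (Fin k) (Fin k) S.carrier) : ‖opMatrix (a.map φ)‖ ≤ S.mnorm k a := by
  refine le_of_forall_gt_imp_ge_of_dense fun t ht => ?_
  have ht0 : 0 < t := (S.mnorm_nonneg a).trans_lt ht
  obtain ⟨G, _, _, _, ι, -, -, h1, hs, hc, hn⟩ := S.exists_rep
  rw [hn] at ht
  let M : Matrix (Fin k ⊕ Fin k) (Fin k ⊕ Fin k) S.carrier :=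
    Matrix.fromBlocks (Matrix.diagonal fun _ => (t : ℂ) • 1) a (a.transpose.map star)
      (Matrix.diagonal fun _ => (t : ℂ) • 1)
  have hdiag : ∀ {E : Type u} [NormedAddCommGroup E] [InnerProductSpace ℂ E]
      (ψ : S.carrier →ₗ[ℂ] (E →L[ℂ] E)), ψ 1 = 1 →
      M.map ψ = Matrix.fromBlocks (Matrix.diagonal fun _ => (t : ℂ) • 1) (a.map ψ)
        ((a.transpose.map star).map ψ) (Matrix.diagonal fun _ => (t : ℂ) • 1) := by
    intro E _ _ ψ hψ
    simp only [M, Matrix.fromBlocks_map]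
    congr 1 <;> (rw [Matrix.diagonal_map (map_zero ψ)]; simp [hψ])
  have hM : (opMatrix (M.map ι)).IsPositive := by
    rw [hdiag ι h1]
    have h2 := block_isPositive ht.le
    convert h2 using 3
    ext i j : 2
    simp [hs]
  have hN : M.submatrix finSumFinEquiv.symm finSumFinEquiv.symm ∈ S.cone (k + k) := by
    rw [hc]
    have h3 := (opMatrix_reindex finSumFinEquiv (M.map ι)).mpr hM
    exact h3
  have h4 := hφ.2 _ _ hN
  have h5 : (opMatrix (M.map φ)).IsPositive :=
    (opMatrix_reindex finSumFinEquiv (M.map φ)).mp h4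
  rw [hdiag φ hφ.1] at h5
  exact norm_le_of_block ht0 h5

theorem norm_le_opMatrix_one (T : H →L[ℂ] H) :
    ‖T‖ ≤ ‖opMatrix (fun _ _ : Fin 1 => T : Matrix (Fin 1) (Fin 1) (H →L[ℂ] H))‖ := by
  refine opNorm_le_of_inner T (ContinuousLinearMap.opNorm_nonneg _) fun x y => ?_
  have hn : ∀ z : H, ‖(WithLp.toLp 2 (fun _ => z) : PiLp 2 (fun _ : Fin 1 => H))‖ = ‖z‖ := by
    intro z
    rw [PiLp.norm_eq_of_L2]
    simp
  have h1 := inner_opMatrix (fun _ _ : Fin 1 => T : Matrix (Fin 1) (Fin 1) (H →L[ℂ] H))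
    (WithLp.toLp 2 (fun _ => x)) (WithLp.toLp 2 (fun _ => y))
  simp only [Fin.sum_univ_one] at h1
  rw [← h1]
  calc _ ≤ _ := norm_inner_le_norm _ _
    _ ≤ _ := mul_le_mul_of_nonneg_left (ContinuousLinearMap.le_opNorm _ _) (norm_nonneg _)
    _ = _ := by rw [hn, hn]; ring

theorem IsUCP.norm_apply_le {φ : S.carrier →ₗ[ℂ] (H →L[ℂ] H)} (hφ : IsUCP S φ) (s : S.carrier) :
    ‖φ s‖ ≤ S.mnorm 1 (fun _ _ => s) :=
  (norm_le_opMatrix_one _).trans (hφ.norm_le _)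

/-- The set of unital completely positive maps is compact in the point-weak* topology. -/
theorem isCompact_setOf_isUCP [CompleteSpace H] :
    @IsCompact _ (pointWeakStar S.carrier H) {φ : S.carrier →ₗ[ℂ] (H →L[ℂ] H) | IsUCP S φ} := by
  let _ := pointWeakStar S.carrier H
  refine isCompact_iff_ultrafilter_le_nhds'.mpr fun F hF => ?_
  let N : S.carrier → ℝ := fun s => S.mnorm 1 (fun _ _ => s)
  have hlim : ∀ (s : S.carrier) (ξ η : H), ∃ c : ℂ, ‖c‖ ≤ N s * ‖ξ‖ * ‖η‖ ∧
      Tendsto (fun φ : S.carrier →ₗ[ℂ] (H →L[ℂ] H) => ⟪φ s ξ, η⟫_ℂ) F (𝓝 c) := by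
    intro s ξ η
    have h1 : ∀ᶠ φ : S.carrier →ₗ[ℂ] (H →L[ℂ] H) in F,
        ⟪φ s ξ, η⟫_ℂ ∈ Metric.closedBall (0 : ℂ) (N s * ‖ξ‖ * ‖η‖) := by
      filter_upwards [hF] with φ hφ
      rw [mem_closedBall_zero_iff]
      refine (norm_inner_le_norm _ _).trans ?_
      gcongr
      exact ContinuousLinearMap.le_of_opNorm_le _ (hφ.norm_apply_le s) _
    obtain ⟨c, hc, hc'⟩ := (isCompact_closedBall (0 : ℂ) (N s * ‖ξ‖ * ‖η‖)).ultrafilter_le_nhds'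
      (F.map fun φ : S.carrier →ₗ[ℂ] (H →L[ℂ] H) => ⟪φ s ξ, η⟫_ℂ) h1
    exact ⟨c, by simpa using hc, hc'⟩
  choose ℓ hℓn hℓ using hlim
  let B : S.carrier → (H →ₗ⋆[ℂ] H →ₗ[ℂ] ℂ) := fun s =>
    LinearMap.mk₂'ₛₗ (starRingEnd ℂ) (RingHom.id ℂ) (ℓ s)
      (fun ξ ξ' η => tendsto_nhds_unique (hℓ s (ξ + ξ') η) (by
        simpa [inner_add_left] using (hℓ s ξ η).add (hℓ s ξ' η)))
      (fun c ξ η => tendsto_nhds_unique (hℓ s (c • ξ) η) (by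
        simpa [inner_smul_left, mul_comm] using (hℓ s ξ η).const_mul (starRingEnd ℂ c)))
      (fun ξ η η' => tendsto_nhds_unique (hℓ s ξ (η + η')) (by
        simpa [inner_add_right] using (hℓ s ξ η).add (hℓ s ξ η')))
      (fun c ξ η => tendsto_nhds_unique (hℓ s ξ (c • η)) (by
        simpa [inner_smul_right] using (hℓ s ξ η).const_mul c))
  let T : S.carrier → (H →L[ℂ] H) := fun s =>
    InnerProductSpace.continuousLinearMapOfBilin ((B s).mkContinuous₂ (N s) (hℓn s))
  have hT : ∀ s ξ η, ⟪T s ξ, η⟫_ℂ = ℓ s ξ η := fun s ξ η => by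
    simp only [T, InnerProductSpace.continuousLinearMapOfBilin_apply]
    rfl
  let φ₀ : S.carrier →ₗ[ℂ] (H →L[ℂ] H) :=
    { toFun := T
      map_add' := fun s s' => by
        ext ξ
        refine ext_inner_right ℂ fun η => ?_
        rw [add_apply, inner_add_left, hT, hT, hT]
        exact tendsto_nhds_unique (hℓ (s + s') ξ η) (by
          simpa [inner_add_left] using (hℓ s ξ η).add (hℓ s' ξ η))
      map_smul' := fun c s => by
        ext ξ
        refine ext_inner_right ℂ fun η => ?_
        rw [RingHom.id_apply, smul_apply, inner_smul_left, hT, hT]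
        exact tendsto_nhds_unique (hℓ (c • s) ξ η) (by
          simpa [inner_smul_left, mul_comm] using (hℓ s ξ η).const_mul (starRingEnd ℂ c)) }
  have hφ₀ : ∀ s ξ η, Tendsto (fun φ : S.carrier →ₗ[ℂ] (H →L[ℂ] H) => ⟪η, φ s ξ⟫_ℂ) F
      (𝓝 ⟪η, φ₀ s ξ⟫_ℂ) := by
    intro s ξ η
    have h1 := (hℓ s ξ η).star
    rw [← hT s ξ η] at h1
    simp only [Complex.star_def, inner_conj_symm] at h1
    exact h1
  have hmem : IsUCP S φ₀ := by
    refine ⟨?_, fun k a ha => ?_⟩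
    · ext ξ
      refine ext_inner_left ℂ fun η => ?_
      refine tendsto_nhds_unique (hφ₀ 1 ξ η) (Tendsto.congr' ?_ tendsto_const_nhds)
      filter_upwards [hF] with φ hφ
      rw [hφ.1]
    · rw [opMatrix_isPositive_iff]
      intro ξ
      refine ge_of_tendsto (tendsto_finsetSum Finset.univ fun i _ =>
        tendsto_finsetSum Finset.univ fun j _ => hφ₀ (a i j) (ξ j) (ξ i)) ?_
      filter_upwards [hF] with φ hφ
      exact (opMatrix_isPositive_iff _).mp (hφ.2 k a ha) ξ
  refine ⟨φ₀, hmem, ?_⟩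
  refine (tendsto_pointWeakStar (f := id)).mpr fun s p => ?_
  refine tendsto_tsum_of_dominated_convergence ((summable_norm_mul p).mul_left (N s))
    (fun k => hφ₀ s (p.1 k) (p.2 k)) ?_
  filter_upwards [hF] with φ hφ k
  exact norm_pairing_term_le p (hφ.norm_apply_le s) k

end UCP

/-- The nc state space `K = ∐ₙ UCP(S, Mₙ)` of an operator system `S`, a compact nc convex set over
the dual operator space `S*`. -/
def stateSpace (κ : Cardinal.{u}) (S : OperatorSystem.{u}) : CompactNCConvexSet κ where
  predual := S.toOperatorSpace
  points n := {φ : S.carrier →ₗ[ℂ] (Hilb n →L[ℂ] Hilb n) | IsUCP S φ}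
  cb n x hx := ⟨1, fun k a => by
    rw [one_mul]
    exact IsUCP.norm_le hx a⟩
  sum_mem I lev n x α y hx _ hα hy := by
    have hy' := pointWeakStarHasSum_iff.mp hy
    refine ⟨?_, fun k a ha => ?_⟩
    · refine (hy' (1 : S.carrier)).unique ?_
      have h1 : (fun i => sandwich (α i) (x i) (adjoint (α i)) (1 : S.carrier))
          = fun i => α i ∘L adjoint (α i) := by
        ext i ζ : 2
        have h2 : x i (1 : S.carrier) = 1 := (hx i).1
        change α i (x i (1 : S.carrier) (adjoint (α i) ζ)) = _
        rw [h2]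
        rfl
      rw [h1]
      exact hα.2
    · rw [opMatrix_isPositive_iff]
      intro ξ
      have h1 : HasSum (fun i => ∑ p, ∑ q,
          ⟪ξ p, sandwich (α i) (x i) (adjoint (α i)) (a p q) (ξ q)⟫_ℂ)
          (∑ p, ∑ q, ⟪ξ p, y (a p q) (ξ q)⟫_ℂ) :=
        hasSum_sum fun p _ => hasSum_sum fun q _ => (hy' (a p q)).inner (ξ q) (ξ p)
      refine h1.nonneg fun i => ?_
      have h2 := (opMatrix_isPositive_iff _).mp ((hx i).2 k a ha)
        fun p => adjoint (α i) (ξ p)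
      simp_rw [ContinuousLinearMap.adjoint_inner_left] at h2
      exact h2
  compress_mem m n β hβ x hx := by
    refine ⟨?_, fun k a ha => ?_⟩
    · have h2 : x (1 : S.carrier) = 1 := hx.1
      change adjoint β ∘L x (1 : S.carrier) ∘L β = 1
      rw [h2]
      exact hβ
    · exact opMatrix_conj_isPositive _ β (hx.2 k a ha)
  isCompact n := isCompact_setOf_isUCP

/-- The continuous affine nc map `x ↦ x ∘ f` from the nc state space of `S` to that of `T` induced
by a unital completely positive map `f : T → S`. -/
def stateSpaceMap (κ : Cardinal.{u}) {T S : OperatorSystem.{u}} (f : UCPMap T S) :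
    CompactNCConvexSet.AffineMap (stateSpace κ S) (stateSpace κ T) where
  toFun n x := ⟨LinearMap.comp (M₂ := S.carrier) x.1 f.toLinearMap, by
    have hx : IsUCP S x.1 := x.2
    refine ⟨?_, fun k a ha => ?_⟩
    · have h := hx.1
      rw [← f.map_one] at h
      exact h
    · exact hx.2 k _ (f.map_cone k a ha)⟩
  map_sum I lev n x α y _ _ hy := by
    rw [pointWeakStarHasSum_iff] at *
    exact fun v => hy (f.toLinearMap v)
  map_compress m n β hβ x := rfl
  continuous_toFun n := by
    let _ := (stateSpace κ S).levelTopology n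
    refine continuous_induced_rng.mpr (continuous_pointWeakStar.mpr fun v p => ?_)
    exact (@continuous_pointWeakStar _ _ _ S.carrier _ _ _ ((stateSpace κ S).levelTopology n) Subtype.val).mp
      (@continuous_induced_dom _ _ Subtype.val (pointWeakStar _ _)) (f.toLinearMap v) p

/-- The functor `A⁻¹` sending a closed operator system to its nc state space. -/
def stateFunctor (κ : Cardinal.{u}) : OperatorSystem.{u} ⥤ (CompactNCConvexSet κ)ᵒᵖ where
  obj S := Opposite.op (stateSpace κ S)
  map f := Quiver.Hom.op (stateSpaceMap κ f : stateSpace κ _ ⟶ stateSpace κ _)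
  map_id _ := rfl
  map_comp _ _ := rfl

end NCConvex

end

open NCConvex

/-! Two facts carry the duality: every UCP map from A(K) to M_n is evaluation at a unique point of
K_n, and every continuous affine nc function on the nc state space of S comes from S. Both follow
from Hahn–Banach separation for compact convex families of linear functionals
(`exists_separating_vector`).

For the first fact, pair a matrix [a_ij] over A(K) with a point x and vectors ξ_i, giving the
functional ∑⟨ξ_i, a_ij(x) ξ_j⟩. As κ is infinite, direct sums of at most κ points stay inside K. By
summing and compressing, any N vectors at any level can be moved to the level of dimension N without
changing these functionals (`exists_point_of_vectors`). Hence those with ∑‖ξ_i‖² = N at level N form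
a compact convex set. Let φ be UCP and e_1, …, e_N orthonormal. If the functional of (φ, e) lay
outside this set, separation would give a and c with Re ≤ c on the set and Re > c at φ. Then (c/N)·1
− Re a is positive over A(K) while its image under φ is not positive at e, a contradiction
(`exists_vectorForm_eq`). Evaluating at 1 shows that the vectors found are again orthonormal, so
every finite corner of φ is the corner of a point at the level of φ, and compactness of K_n produces
a single point (`exists_evalMap_eq`). Elements of the predual are themselves functions in A(K),
which yields uniqueness of the point and continuity of the inverse map.

For the second fact, positivity and norms in a concrete representation of S are tested on finitely
many vectors. The compressions to their spans are points of the nc state space, so s ↦ ŝ is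
injective and reflects positivity. For surjectivity let f be self-adjoint. Two states at a
one-dimensional level which agree on S are the same point, hence agree on f. Separation makes this
quantitative: f is approximated by elements of S on all one-dimensional states
(`exists_hat_approx`). The numerical radius controls the norm up to a factor 4, so the approximation
is uniform on all levels, and the limit lies in S because S is norm closed. -/

noncomputable section

namespace NCConvex

/-! ### Separation of linear functionals -/

/-- A linear functional outside a compact convex family of linear functionals, with the topology of
pointwise convergence, is strictly separated from it by a vector. -/
theorem exists_separating_vector {W X : Type*} [AddCommGroup W] [Module ℂ W] [TopologicalSpace X]
    [CompactSpace X] (Ψ : X → W →ₗ[ℂ] ℂ) (hΨ : ∀ w, Continuous fun x => Ψ x w)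
    (hconv : ∀ x y (s t : ℝ), 0 ≤ s → 0 ≤ t → s + t = 1 →
      ∃ z, Ψ z = (s : ℂ) • Ψ x + (t : ℂ) • Ψ y)
    (φ : W →ₗ[ℂ] ℂ) (hφ : ∀ x, Ψ x ≠ φ) :
    ∃ (w : W) (c : ℝ), (∀ x, (Ψ x w).re ≤ c) ∧ c < (φ w).re := by
  classical
  by_contra! hcon
  -- On finitely many coordinates the family has a compact convex image in a finite-dimensional
  -- space, where failure of separation forces exact agreement with `φ` at some `x`. Compactness of
  -- `X` then passes from finite sets to all of `W`.
  have hfin : ∀ F : Finset W, ∃ x, ∀ w ∈ F, Ψ x w = φ w := by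
    intro F
    by_contra! hF
    let Γ : X → (F → ℂ) := fun x w => Ψ x w
    have hΓ : Continuous Γ := continuous_pi fun w => hΨ w
    have hcvx : Convex ℝ (Set.range Γ) := by
      rintro _ ⟨x, rfl⟩ _ ⟨y, rfl⟩ s t hs ht hst
      obtain ⟨z, hz⟩ := hconv x y s t hs ht hst
      exact ⟨z, by ext w; simp [Γ, hz]⟩
    have hnot : (fun w : F => φ w) ∉ Set.range Γ := by
      rintro ⟨x, hx⟩
      obtain ⟨w, hw, hne⟩ := hF x
      exact hne (congrFun hx ⟨w, hw⟩)
    obtain ⟨f, c, hf, hc⟩ := RCLike.geometric_hahn_banach_closed_point (𝕜 := ℂ) hcvx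
      (isCompact_range hΓ).isClosed hnot
    -- A functional on the coordinate space is evaluation at a vector of `W`: its coefficients on
    -- the coordinate vectors give a linear combination of the elements of `F`.
    have hrep : ∀ θ : W →ₗ[ℂ] ℂ,
        θ (∑ w : F, f (Pi.single w 1) • (w : W)) = f fun w : F => θ w := by
      intro θ
      rw [map_sum]
      conv_rhs => rw [pi_eq_sum_univ' (fun w : F => θ w), map_sum]
      refine Finset.sum_congr rfl fun w _ => ?_
      rw [map_smul, map_smul, smul_eq_mul, smul_eq_mul, mul_comm]
    refine (hcon _ c fun x => ?_).not_gt (by rw [hrep]; exact hc)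
    rw [hrep]
    exact (hf _ ⟨x, rfl⟩).le
  obtain ⟨x, hx⟩ := CompactSpace.iInter_nonempty (ι := W) (t := fun w => {x | Ψ x w = φ w})
    (fun w => isClosed_eq (hΨ w) continuous_const)
    (fun F => (hfin F).imp fun x hx => by simpa using hx)
  exact hφ x (LinearMap.ext fun w => Set.mem_iInter.mp hx w)

/-! ### Levels, and isometries from orthonormal families -/

section Levels

variable {κ : Cardinal.{u}}

open ContinuousLinearMap (adjoint)

/-- The level of a nonzero cardinal `c ≤ κ`. -/
def Level.of (c : Cardinal.{u}) (h0 : c ≠ 0) (h : c ≤ κ) : Level κ :=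
  equivShrink (Set.Ioc (0 : Cardinal.{u}) κ) ⟨c, pos_iff_ne_zero.mpr h0, h⟩

theorem Level.mk_index (n : Level κ) : Cardinal.mk n.Index = n.card := Cardinal.mk_out _

theorem Level.card_le (n : Level κ) : n.card ≤ κ :=
  ((equivShrink (Set.Ioc (0 : Cardinal.{u}) κ)).symm n).2.2

theorem Level.card_ne_zero (n : Level κ) : n.card ≠ 0 :=
  (((equivShrink (Set.Ioc (0 : Cardinal.{u}) κ)).symm n).2.1).ne'

theorem Level.mk_index_of (c : Cardinal.{u}) (h0 : c ≠ 0) (h : c ≤ κ) :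
    Cardinal.mk (Level.of c h0 h).Index = c := by
  rw [Level.mk_index]
  simp [Level.of, Level.card]

instance (n : Level κ) : Nonempty n.Index := by
  rw [← Cardinal.mk_ne_zero_iff, n.mk_index]
  exact n.card_ne_zero

/-- There is a level indexed by any given nonempty type of cardinality at most `κ`. -/
theorem Level.exists_equiv (X : Type u) [Nonempty X] (h : Cardinal.mk X ≤ κ) :
    ∃ n : Level κ, Nonempty (X ≃ n.Index) :=
  ⟨Level.of _ (Cardinal.mk_ne_zero X) h, Cardinal.eq.mp (Level.mk_index_of _ _ _).symm⟩

/-- The standard basis of `ℓ²(n)`. -/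
def Hilb.basis (n : Level κ) : HilbertBasis n.Index ℂ (Hilb n) :=
  HilbertBasis.ofRepr (LinearIsometryEquiv.refl ℂ (lp (fun _ : n.Index => ℂ) 2))

/-- An orthonormal family indexed by `n` is the image of the standard basis of `ℓ²(n)` under an
isometry. -/
theorem exists_isometry_of_orthonormal {n : Level κ} {H : Type u} [NormedAddCommGroup H]
    [InnerProductSpace ℂ H] [CompleteSpace H] {v : n.Index → H} (hv : Orthonormal ℂ v) :
    ∃ β : Hilb n →ₗᵢ[ℂ] H, ∀ i, β (Hilb.basis n i) = v i := by
  classical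
  refine ⟨hv.orthogonalFamily.linearIsometry.comp (Hilb.basis n).repr.toLinearIsometry,
    fun i => ?_⟩
  simp [HilbertBasis.repr_self, OrthogonalFamily.linearIsometry_apply_single]

theorem clm_ext_hilbertBasis {ι E F : Type*} [NormedAddCommGroup E] [InnerProductSpace ℂ E]
    [NormedAddCommGroup F] [NormedSpace ℂ F] (b : HilbertBasis ι ℂ E) {S T : E →L[ℂ] F}
    (h : ∀ i, S (b i) = T (b i)) : S = T :=
  ContinuousLinearMap.ext_on (Submodule.dense_iff_topologicalClosure_eq_top.mpr b.dense_span)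
    (by rintro _ ⟨i, rfl⟩; exact h i)

theorem ext_inner_hilbertBasis {ι E : Type*} [NormedAddCommGroup E] [InnerProductSpace ℂ E]
    (b : HilbertBasis ι ℂ E) {x y : E} (h : ∀ i, ⟪b i, x⟫_ℂ = ⟪b i, y⟫_ℂ) : x = y :=
  b.repr.injective (by ext i; simpa only [HilbertBasis.repr_apply_apply] using h i)

theorem adjoint_comp_linearIsometry {G H : Type u} [NormedAddCommGroup G] [InnerProductSpace ℂ G]
    [CompleteSpace G] [NormedAddCommGroup H] [InnerProductSpace ℂ H] [CompleteSpace H]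
    (V : G →ₗᵢ[ℂ] H) :
    adjoint V.toContinuousLinearMap ∘L V.toContinuousLinearMap = 1 :=
  (ContinuousLinearMap.norm_map_iff_adjoint_comp_self _).mp V.norm_map

end Levels

/-! ### Hilbert sums and decompositions of the identity -/

section DirectSum

open ContinuousLinearMap (adjoint)

variable {H : Type u} [NormedAddCommGroup H] [InnerProductSpace ℂ H] {J : Type u}

/-- On norm bounded sets weak operator convergence implies ultraweak convergence, by dominated
convergence in the series defining `pairing`. -/
theorem weakStarHasSum_of_norm_le {T : J → H →L[ℂ] H} {S : H →L[ℂ] H} {C : ℝ}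
    (hC : ∀ F : Finset J, ‖∑ j ∈ F, T j‖ ≤ C)
    (h : ∀ ξ η, HasSum (fun j => ⟪η, T j ξ⟫_ℂ) ⟪η, S ξ⟫_ℂ) : WeakStarHasSum T S := by
  unfold WeakStarHasSum HasSum
  rw [tendsto_weakStar]
  intro p
  refine tendsto_tsum_of_dominated_convergence ((summable_norm_mul p).mul_left C)
    (fun k => ?_) (Eventually.of_forall fun F k => norm_pairing_term_le p (hC F) k)
  have h1 := h (p.1 k) (p.2 k)
  simpa [HasSum, inner_sum, sum_apply] using h1

variable [CompleteSpace H] {G : J → Type u} [∀ j, NormedAddCommGroup (G j)]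
  [∀ j, InnerProductSpace ℂ (G j)] {V : ∀ j, G j →ₗᵢ[ℂ] H}

/-- The direct sum of a pointwise bounded family of linear maps into `B(Gⱼ)`, along a Hilbert sum
decomposition. -/
theorem exists_directSum (hV : IsHilbertSum ℂ G V) {A : Type u} [AddCommGroup A] [Module ℂ A]
    (x : ∀ j, A →ₗ[ℂ] (G j →L[ℂ] G j)) (hb : ∀ a, ∃ C, 0 ≤ C ∧ ∀ j, ‖x j a‖ ≤ C) :
    ∃ y : A →ₗ[ℂ] (H →L[ℂ] H), ∀ a j ζ, y a (V j ζ) = V j (x j a ζ) := by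
  classical
  refine ⟨sandwich hV.linearIsometryEquiv.symm.toLinearIsometry.toContinuousLinearMap
    (diagRep x hb) hV.linearIsometryEquiv.toLinearIsometry.toContinuousLinearMap,
    fun a j ζ => ?_⟩
  change hV.linearIsometryEquiv.symm (diagRep x hb a (hV.linearIsometryEquiv (V j ζ))) = _
  rw [← hV.linearIsometryEquiv_symm_apply_single, LinearIsometryEquiv.apply_symm_apply,
    diag_single (T := fun j => x j a) (diagRep_apply x hb a),
    hV.linearIsometryEquiv_symm_apply_single]

variable [∀ j, CompleteSpace (G j)]

theorem linearIsometryEquiv_apply_eq_adjoint (hV : IsHilbertSum ℂ G V) (ξ : H) (j : J) :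
    hV.linearIsometryEquiv ξ j = adjoint (V j).toContinuousLinearMap ξ := by
  classical
  refine ext_inner_left ℂ fun η => ?_
  rw [ContinuousLinearMap.adjoint_inner_right, ← lp.inner_single_left,
    ← hV.linearIsometryEquiv.symm.inner_map_map, LinearIsometryEquiv.symm_apply_apply,
    hV.linearIsometryEquiv_symm_apply_single]
  rfl

/-- A Hilbert sum decomposition is a decomposition of the identity into isometries. -/
theorem isIsometryDecomposition_of_isHilbertSum (hV : IsHilbertSum ℂ G V) :
    IsIsometryDecomposition fun j => (V j).toContinuousLinearMap := by
  have key : ∀ ξ η j, ⟪η, ((V j).toContinuousLinearMap ∘L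
      adjoint (V j).toContinuousLinearMap) ξ⟫_ℂ
        = ⟪hV.linearIsometryEquiv η j, hV.linearIsometryEquiv ξ j⟫_ℂ := fun ξ η j => by
    rw [linearIsometryEquiv_apply_eq_adjoint, linearIsometryEquiv_apply_eq_adjoint,
      ContinuousLinearMap.adjoint_inner_left]
    rfl
  refine ⟨fun j => adjoint_comp_linearIsometry (V j),
    weakStarHasSum_of_norm_le (C := 1) (fun F => ?_) fun ξ η => ?_⟩
  · refine opNorm_le_of_inner _ zero_le_one fun ξ η => ?_
    -- Bessel's inequality; with Cauchy–Schwarz it shows that the finite partial sums of the range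
    -- projections are contractions.
    have hsq : ∀ ζ : H, √(∑ j ∈ F, ‖hV.linearIsometryEquiv ζ j‖ ^ 2) ≤ ‖ζ‖ := fun ζ => by
      rw [← Real.sqrt_sq (norm_nonneg ζ), ← hV.linearIsometryEquiv.norm_map ζ]
      exact Real.sqrt_le_sqrt
        (sum_le_hasSum F (fun _ _ => by positivity) (lp_hasSum_norm_sq _))
    rw [sum_apply, inner_sum]
    simp_rw [key]
    refine (norm_sum_le _ _).trans ((Finset.sum_le_sum fun j _ => norm_inner_le_norm _ _).trans
      ((Real.sum_mul_le_sqrt_mul_sqrt F _ _).trans ?_))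
    rw [one_mul, mul_comm]
    gcongr <;> exact hsq _
  · simp_rw [key]
    have h := lp.hasSum_inner (𝕜 := ℂ) (hV.linearIsometryEquiv η) (hV.linearIsometryEquiv ξ)
    rwa [LinearIsometryEquiv.inner_map_map] at h

/-- A partition of `q` into sets of cardinality `p j` yields a Hilbert sum decomposition. -/
theorem exists_isHilbertSum {κ : Cardinal.{u}} {p : J → Level κ} {q : Level κ}
    (e : (Σ j, (p j).Index) ≃ q.Index) :
    ∃ V : ∀ j, Hilb (p j) →ₗᵢ[ℂ] Hilb q, IsHilbertSum ℂ (fun j => Hilb (p j)) V := by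
  classical
  have hort : ∀ j, Orthonormal ℂ fun k : (p j).Index => Hilb.basis q (e ⟨j, k⟩) := fun j =>
    (Hilb.basis q).orthonormal.comp (fun k => e ⟨j, k⟩)
      (e.injective.comp sigma_mk_injective)
  choose V hV using fun j => exists_isometry_of_orthonormal (hort j)
  have hzero : ∀ i j, i ≠ j → ∀ (ξ : Hilb (p i)) (η : Hilb (p j)), ⟪V i ξ, V j η⟫_ℂ = 0 := by
    intro i j hij ξ η
    have h1 : adjoint (V i).toContinuousLinearMap ∘L (V j).toContinuousLinearMap = 0 := by
      refine clm_ext_hilbertBasis (Hilb.basis _) fun k =>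
        ext_inner_hilbertBasis (Hilb.basis _) fun l => ?_
      rw [ContinuousLinearMap.comp_apply, ContinuousLinearMap.adjoint_inner_right]
      change ⟪V i _, V j _⟫_ℂ = ⟪_, (0 : Hilb (p i))⟫_ℂ
      rw [hV, hV, inner_zero_right]
      exact (Hilb.basis q).orthonormal.2 fun h => hij (congrArg Sigma.fst (e.injective h))
    have h2 := congrArg (fun T => ⟪ξ, T η⟫_ℂ) h1
    simpa [ContinuousLinearMap.adjoint_inner_right] using h2
  refine ⟨V, IsHilbertSum.mk hzero ?_⟩
  rw [← (Hilb.basis q).dense_span]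
  refine Submodule.topologicalClosure_mono (Submodule.span_le.mpr ?_)
  rintro _ ⟨k, rfl⟩
  obtain ⟨⟨j, l⟩, rfl⟩ := e.surjective k
  refine Submodule.mem_iSup_of_mem j ⟨Hilb.basis _ l, ?_⟩
  exact hV j l

end DirectSum

open ContinuousLinearMap (adjoint)

/-! ### Moving points and vectors between levels -/

namespace CompactNCConvexSet

variable {κ : Cardinal.{u}} {K : CompactNCConvexSet κ}

theorem exists_norm_apply_le {J : Type u} {p : J → Level κ}
    {x : ∀ j, K.points (p j)} (hx : ∃ C, ∀ j, CBBound K.predual (x j).1 C)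
    (v : K.predual.carrier) : ∃ C, 0 ≤ C ∧ ∀ j, ‖(x j).1 v‖ ≤ C := by
  obtain ⟨C, hC⟩ := hx
  refine ⟨|C * K.predual.mnorm 1 fun _ _ => v|, abs_nonneg _, fun j => ?_⟩
  exact (norm_le_opMatrix_one _).trans ((hC j 1 fun _ _ => v).trans (le_abs_self _))

/-- Direct sums of points of a compact nc convex set. -/
theorem exists_directSum_point (hκ : Cardinal.aleph0 ≤ κ) {J : Type u} [Nonempty J]
    (hJ : Cardinal.mk J ≤ κ) {p : J → Level κ} (x : ∀ j, K.points (p j))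
    (hx : ∃ C, ∀ j, CBBound K.predual (x j).1 C) :
    ∃ (q : Level κ) (y : K.points q) (V : ∀ j, Hilb (p j) →ₗᵢ[ℂ] Hilb q),
      OrthogonalFamily ℂ (fun j => Hilb (p j)) V ∧
      ∀ a, K.IsContAffine a → ∀ j ζ, a q y (V j ζ) = V j (a _ (x j) ζ) := by
  -- Here κ · κ = κ is used: the direct sum has dimension at most κ, so it is again a level.
  have hcard : Cardinal.mk (Σ j, (p j).Index) ≤ κ := by
    rw [Cardinal.mk_sigma]
    refine (Cardinal.sum_le_sum _ (fun _ => κ) fun j => ?_).trans ?_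
    · rw [Level.mk_index]; exact (p j).card_le
    · rw [Cardinal.sum_const']
      exact Cardinal.mul_le_of_le hκ hJ le_rfl
  have : Nonempty (Σ j, (p j).Index) :=
    ‹Nonempty J›.elim fun j => ⟨⟨j, Classical.arbitrary _⟩⟩
  obtain ⟨q, ⟨e⟩⟩ := Level.exists_equiv (κ := κ) (Σ j, (p j).Index) hcard
  obtain ⟨V, hV⟩ := exists_isHilbertSum e
  have hα := isIsometryDecomposition_of_isHilbertSum hV
  obtain ⟨y, hy⟩ := exists_directSum hV (fun j => (x j).1) (exists_norm_apply_le hx)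
  have hsum := (pointWeakStarHasSum_sandwich_iff hα).mpr fun v j ζ => hy v j ζ
  refine ⟨q, ⟨y, K.sum_mem J p q _ _ y (fun j => (x j).2) hx hα hsum⟩, V,
    hV.OrthogonalFamily, fun a ha => ?_⟩
  exact hα.hasSum_iff.mp (ha.map_sum J p q x _ _ hx hα hsum)

/-- Every point can be moved to any other level, while keeping a prescribed corner. -/
theorem exists_point_of_orthonormal (hκ : Cardinal.aleph0 ≤ κ) {p n : Level κ} (x : K.points p)
    (s : Set n.Index) (b : n.Index → Hilb p) (hb : Orthonormal ℂ fun i : s => b i) :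
    ∃ z : K.points n, ∀ a, K.IsContAffine a → ∀ i ∈ s, ∀ j ∈ s,
      ⟪Hilb.basis n i, a n z (Hilb.basis n j)⟫_ℂ = ⟪b i, a p x (b j)⟫_ℂ := by
  classical
  -- In a sum of copies of `x`, the copy `none` carries the prescribed corner, and each index
  -- outside `s` receives a unit vector in a copy of its own. The resulting family is orthonormal
  -- whatever the dimension of `Hilb p`.
  have hJ : Cardinal.mk (Option n.Index) ≤ κ := by
    rw [Cardinal.mk_option, Level.mk_index]
    exact Cardinal.add_le_of_le hκ n.card_le (Cardinal.one_le_aleph0.trans hκ)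
  obtain ⟨q, y, V, hV, hy⟩ := exists_directSum_point (K := K) hκ hJ (fun _ => x)
    ((K.cb p x.1 x.2).imp fun C hC _ => hC)
  let w : Hilb p := Hilb.basis p (Classical.arbitrary _)
  have hw : ‖w‖ = 1 := (Hilb.basis p).orthonormal.1 _
  let v : n.Index → Hilb q := fun k => if k ∈ s then V none (b k) else V (some k) w
  have hv : Orthonormal ℂ v := by
    refine ⟨fun k => ?_, fun k l hkl => ?_⟩
    · by_cases hk : k ∈ s
      · simpa [v, hk] using hb.1 ⟨k, hk⟩
      · simpa [v, hk] using hw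
    · by_cases hk : k ∈ s <;> by_cases hl : l ∈ s
      · simpa [v, hk, hl] using hb.2 (i := ⟨k, hk⟩) (j := ⟨l, hl⟩) (by simpa using hkl)
      · simpa [v, hk, hl] using hV (by simp : none ≠ some l) (b k) w
      · simpa [v, hk, hl] using hV (by simp : some k ≠ none) w (b l)
      · simpa [v, hk, hl] using hV (by simpa using hkl : some k ≠ some l) w w
  obtain ⟨β, hβ⟩ := exists_isometry_of_orthonormal hv
  have hβ1 := adjoint_comp_linearIsometry β
  refine ⟨⟨_, K.compress_mem n q _ hβ1 y.1 y.2⟩, fun a ha i hi j hj => ?_⟩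
  rw [ha.map_compress n q _ hβ1 y, ContinuousLinearMap.comp_apply, ContinuousLinearMap.comp_apply,
    ContinuousLinearMap.adjoint_inner_right]
  change ⟪β _, a q y (β _)⟫_ℂ = _
  rw [hβ, hβ]
  simp [v, hi, hj, hy a ha]

/-- Finitely many vectors at any level can be moved to a given level of sufficient dimension. -/
theorem exists_point_of_vectors (hκ : Cardinal.aleph0 ≤ κ) {p n : Level κ} [Fintype n.Index]
    (x : K.points p) (ξ : n.Index → Hilb p) :
    ∃ (z : K.points n) (ζ : n.Index → Hilb n), ∀ a, K.IsContAffine a → ∀ i j,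
      ⟪ζ i, a n z (ζ j)⟫_ℂ = ⟪ξ i, a p x (ξ j)⟫_ℂ := by
  classical
  let U := Submodule.span ℂ (Set.range ξ)
  have : FiniteDimensional ℂ U := FiniteDimensional.span_of_finite ℂ (Set.finite_range ξ)
  let B := stdOrthonormalBasis ℂ U
  -- The span of the vectors has dimension at most their number, so an orthonormal basis of it can
  -- be matched with part of the basis of `Hilb n`. The vectors `ζ` then have the same coordinates
  -- as the `ξ`.
  obtain ⟨c⟩ : Nonempty (Fin (Module.finrank ℂ U) ↪ n.Index) :=
    Function.Embedding.nonempty_of_card_le (by rw [Fintype.card_fin]; exact finrank_range_le_card ξ)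
  let b : n.Index → Hilb p := Function.extend c (fun l => (B l : Hilb p)) 0
  have hb : ∀ l, b (c l) = B l := fun l => c.injective.extend_apply _ _ _
  have hort : Orthonormal ℂ fun l => b (c l) := by
    simp_rw [hb]
    exact B.orthonormal.comp_linearIsometry U.subtypeₗᵢ
  obtain ⟨z, hz⟩ := exists_point_of_orthonormal hκ x (Set.range c) b (by
    have h := hort.comp (Equiv.ofInjective c c.injective).symm (Equiv.injective _)
    convert h using 2 with i
    obtain ⟨l, hl⟩ := (Equiv.ofInjective c c.injective).surjective i
    simp [← hl])
  have hξ : ∀ i, ξ i = ∑ l, B.repr ⟨ξ i, Submodule.subset_span ⟨i, rfl⟩⟩ l • b (c l) := by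
    intro i
    have h := congrArg Subtype.val (B.sum_repr ⟨ξ i, Submodule.subset_span ⟨i, rfl⟩⟩)
    simp_rw [hb]
    simpa using h.symm
  refine ⟨z, fun i => ∑ l, B.repr ⟨ξ i, Submodule.subset_span ⟨i, rfl⟩⟩ l • Hilb.basis n (c l),
    fun a ha i j => ?_⟩
  conv_rhs => rw [hξ i, hξ j]
  simp only [map_sum, map_smul, sum_inner, inner_sum, inner_smul_left, inner_smul_right]
  refine Finset.sum_congr rfl fun k _ => congrArg _ (Finset.sum_congr rfl fun l _ => ?_)
  rw [hz a ha _ ⟨_, rfl⟩ _ ⟨_, rfl⟩]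

/-- Evaluate the direct sum of `x` and `y` at the vectors √s ξ_i ⊕ √t η_i: the cross terms vanish,
and the tuple can be moved back to level `n`. This is the source of convexity for the functionals to
be separated. -/
theorem exists_point_of_pair (hκ : Cardinal.aleph0 ≤ κ) {n : Level κ} [Fintype n.Index]
    (x y : K.points n) (ξ η : n.Index → Hilb n) {s t : ℝ} (hs : 0 ≤ s) (ht : 0 ≤ t) :
    ∃ (z : K.points n) (ζ : n.Index → Hilb n), ∀ a, K.IsContAffine a → ∀ i j,
      ⟪ζ i, a n z (ζ j)⟫_ℂ = s * ⟪ξ i, a n x (ξ j)⟫_ℂ + t * ⟪η i, a n y (η j)⟫_ℂ := by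
  classical
  have hJ : Cardinal.mk (ULift.{u} Bool) ≤ κ := (Cardinal.lt_aleph0_of_finite _).le.trans hκ
  obtain ⟨C, hC⟩ := K.cb n x.1 x.2
  obtain ⟨D, hD⟩ := K.cb n y.1 y.2
  -- A direct sum needs one bound for both summands. Matrix norms are nonnegative, so `max C D`
  -- serves.
  have hmono : ∀ {φ : K.predual.carrier →ₗ[ℂ] (Hilb n →L[ℂ] Hilb n)} {c d : ℝ}, c ≤ d →
      CBBound K.predual φ c → CBBound K.predual φ d := fun {φ c d} hcd h k a => by
    refine (h k a).trans (mul_le_mul_of_nonneg_right hcd ?_)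
    obtain ⟨H, _, _, _, ι, -, -, hι⟩ := K.predual.exists_rep
    rw [hι]
    exact norm_nonneg _
  obtain ⟨q, w, V, hV, hw⟩ := exists_directSum_point (K := K) hκ hJ
    (p := fun _ => n) (fun j => if j.down then x else y) ⟨max C D, fun ⟨j⟩ => by
      cases j
      · exact hmono (le_max_right C D) hD
      · exact hmono (le_max_left C D) hC⟩
  obtain ⟨z, ζ, hz⟩ := exists_point_of_vectors hκ w
    fun i => V ⟨true⟩ ((√s : ℂ) • ξ i) + V ⟨false⟩ ((√t : ℂ) • η i)
  refine ⟨z, ζ, fun a ha i j => ?_⟩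
  have h1 : ∀ u v, ⟪V ⟨true⟩ u, V ⟨false⟩ v⟫_ℂ = 0 := fun u v => hV (by simp) u v
  have h2 : ∀ u v, ⟪V ⟨false⟩ u, V ⟨true⟩ v⟫_ℂ = 0 := fun u v => hV (by simp) u v
  have hs2 : ((√s : ℝ) : ℂ) * (√s : ℝ) = s := by rw [← Complex.ofReal_mul, Real.mul_self_sqrt hs]
  have ht2 : ((√t : ℝ) : ℂ) * (√t : ℝ) = t := by rw [← Complex.ofReal_mul, Real.mul_self_sqrt ht]
  rw [hz a ha]
  simp only [map_add, hw a ha, inner_add_left, inner_add_right, h1, h2,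
    LinearIsometry.inner_map_map,
    map_smul, inner_smul_left, inner_smul_right, Complex.conj_ofReal, if_true]
  simp only [Bool.false_eq_true, if_false, mul_zero, add_zero, zero_add]
  linear_combination ⟪ξ i, a n x (ξ j)⟫_ℂ * hs2 + ⟪η i, a n y (η j)⟫_ℂ * ht2

end CompactNCConvexSet

/-! ### Self-adjointness of UCP maps, and quadratic forms on matrices -/

/-- Unital completely positive maps are self-adjoint. -/
theorem IsUCP.map_star {S : OperatorSystem.{u}} {H : Type u} [NormedAddCommGroup H]
    [InnerProductSpace ℂ H] [CompleteSpace H] {φ : S.carrier →ₗ[ℂ] (H →L[ℂ] H)}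
    (hφ : IsUCP S φ) (s : S.carrier) : φ (star s) = adjoint (φ s) := by
  obtain ⟨G, _, _, _, ι, -, -, h1, hs, hc, -⟩ := S.exists_rep
  -- This matrix is positive because |⟨ξ₀, s ξ₁⟩| ≤ ‖s‖ ‖ξ₀‖ ‖ξ₁‖. Its image under φ therefore has a
  -- real quadratic form, which relates the two off-diagonal entries.
  let M : Matrix (Fin 2) (Fin 2) S.carrier :=
    !![((‖ι s‖ : ℝ) : ℂ) • 1, s; star s, ((‖ι s‖ : ℝ) : ℂ) • 1]
  have hM : M ∈ S.cone 2 := by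
    rw [hc, opMatrix_isPositive_iff]
    intro ξ
    simp only [M, Matrix.map_apply, Fin.sum_univ_two, Matrix.of_apply, Matrix.cons_val_zero,
      Matrix.cons_val_one, Matrix.cons_val', map_smul, h1, hs, smul_apply, one_apply_eq_self,
      inner_smul_right, ContinuousLinearMap.adjoint_inner_right, inner_self_eq_norm_sq_to_K]
    have h2 : (⟪ι s (ξ 1), ξ 0⟫_ℂ).re = (⟪ξ 0, ι s (ξ 1)⟫_ℂ).re := by
      rw [← inner_conj_symm, Complex.conj_re]
    have h2' : (⟪ι s (ξ 1), ξ 0⟫_ℂ).im = -(⟪ξ 0, ι s (ξ 1)⟫_ℂ).im := by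
      rw [← inner_conj_symm, Complex.conj_im]
    have h3 : |(⟪ξ 0, ι s (ξ 1)⟫_ℂ).re| ≤ ‖ξ 0‖ * (‖ι s‖ * ‖ξ 1‖) :=
      (Complex.abs_re_le_norm _).trans ((norm_inner_le_norm _ _).trans (by
        gcongr; exact ContinuousLinearMap.le_opNorm _ _))
    rw [Complex.nonneg_iff]
    have h4 := (abs_le.mp h3).1
    constructor
    · simp [← Complex.ofReal_pow, h2]
      nlinarith [mul_nonneg (norm_nonneg (ι s)) (sq_nonneg (‖ξ 0‖ - ‖ξ 1‖))]
    · simp [← Complex.ofReal_pow, h2']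
  have h2 := (opMatrix_isPositive_iff _).mp (hφ.2 2 M hM)
  have h3 : ∀ u v, (⟪u, φ s v⟫_ℂ).im + (⟪v, φ (star s) u⟫_ℂ).im = 0 := fun u v => by
    have h4 := (Complex.nonneg_iff.mp (h2 ![u, v])).2
    simp only [M, Matrix.map_apply, Fin.sum_univ_two, Matrix.of_apply, Matrix.cons_val_zero,
      Matrix.cons_val_one, Matrix.cons_val', map_smul, hφ.1, smul_apply, one_apply_eq_self,
      inner_smul_right, inner_self_eq_norm_sq_to_K] at h4
    simpa [← Complex.ofReal_pow] using h4.symm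
  ext u
  refine ext_inner_left ℂ fun v => ?_
  rw [ContinuousLinearMap.adjoint_inner_right, ← inner_conj_symm]
  have h5 := h3 u v
  -- Reality of the form only compares imaginary parts; replacing `v` by `I • v` compares the real
  -- parts.
  have h6 := h3 u (Complex.I • v)
  simp only [map_smul, inner_smul_left, inner_smul_right] at h6
  rw [← inner_conj_symm (φ s v) u]
  simp only [Complex.mul_im, Complex.conj_I, Complex.neg_re, Complex.neg_im,
    Complex.I_re, Complex.I_im] at h6
  apply Complex.ext
  · simp only [inner_conj_symm]
    rw [← inner_conj_symm (φ s v) u, Complex.conj_re]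
    linarith
  · simp only [inner_conj_symm]
    rw [← inner_conj_symm (φ s v) u, Complex.conj_im]
    linarith

section MatrixForm

variable {A : Type*} [AddCommGroup A] [Module ℂ A] {H : Type*} [NormedAddCommGroup H]
  [InnerProductSpace ℂ H] {ι : Type*} [Fintype ι]

/-- The linear functional `[aᵢⱼ] ↦ ∑ᵢⱼ ⟪ξᵢ, T(aᵢⱼ) ξⱼ⟫` on matrices over `A`. -/
def matrixForm (T : A →ₗ[ℂ] (H →L[ℂ] H)) (ξ : ι → H) : Matrix ι ι A →ₗ[ℂ] ℂ where
  toFun a := ∑ i, ∑ j, ⟪ξ i, T (a i j) (ξ j)⟫_ℂ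
  map_add' a b := by simp [Finset.sum_add_distrib]
  map_smul' c a := by simp [Finset.mul_sum]

theorem matrixForm_apply (T : A →ₗ[ℂ] (H →L[ℂ] H)) (ξ : ι → H) (a : Matrix ι ι A) :
    matrixForm T ξ a = ∑ i, ∑ j, ⟪ξ i, T (a i j) (ξ j)⟫_ℂ := rfl

/-- Through matrix units, an equality of two such functionals becomes an equality of all their
individual matrix coefficients. -/
theorem matrixForm_single [DecidableEq ι] (T : A →ₗ[ℂ] (H →L[ℂ] H)) (ξ : ι → H) (i j : ι)
    (a : A) : matrixForm T ξ (Matrix.single i j a) = ⟪ξ i, T a (ξ j)⟫_ℂ := by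
  rw [matrixForm_apply, Finset.sum_eq_single i, Finset.sum_eq_single j]
  · simp
  · intro l _ hl; simp [hl.symm]
  · simp
  · intro k _ hk
    exact Finset.sum_eq_zero fun l _ => by simp [hk.symm]
  · simp

theorem matrixForm_smul (T : A →ₗ[ℂ] (H →L[ℂ] H)) (ξ : ι → H) (r : ℝ) (a : Matrix ι ι A) :
    matrixForm T (fun i => (r : ℂ) • ξ i) a = (r ^ 2 : ℝ) * matrixForm T ξ a := by
  simp only [matrixForm_apply, map_smul, inner_smul_left, inner_smul_right, Complex.conj_ofReal,
    Finset.mul_sum]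
  refine Finset.sum_congr rfl fun i _ => Finset.sum_congr rfl fun j _ => ?_
  push_cast
  ring

/-- A multiple of the identity matrix minus the hermitian part of `a`. -/
def hermitianDefect [DecidableEq ι] [StarAddMonoid A] [One A] (c : ℝ) (a : Matrix ι ι A) :
    Matrix ι ι A :=
  (c : ℂ) • Matrix.diagonal (fun _ => 1) - (2⁻¹ : ℂ) • (a + a.transpose.map star)

/-- The form takes conjugate values at a matrix and its adjoint, so only the real part survives. A
bound on the real part of a functional thereby becomes a positivity statement, to which a UCP map
can be applied. -/
theorem matrixForm_hermitianDefect [CompleteSpace H] [DecidableEq ι] [StarAddMonoid A] [One A]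
    {T : A →ₗ[ℂ] (H →L[ℂ] H)} (h1 : T 1 = 1) (hs : ∀ a, T (star a) = adjoint (T a)) (ξ : ι → H)
    (c : ℝ) (a : Matrix ι ι A) : matrixForm T ξ (hermitianDefect c a) =
      ((c * ∑ i, ‖ξ i‖ ^ 2 - (matrixForm T ξ a).re : ℝ) : ℂ) := by
  have hd : matrixForm T ξ (Matrix.diagonal fun _ => 1) = ((∑ i, ‖ξ i‖ ^ 2 : ℝ) : ℂ) := by
    rw [matrixForm_apply, Complex.ofReal_sum]
    refine Finset.sum_congr rfl fun i _ => ?_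
    rw [Finset.sum_eq_single i]
    · simp [h1, inner_self_eq_norm_sq_to_K]
    · intro j _ hj; simp [Matrix.diagonal_apply_ne _ hj.symm]
    · simp
  have hadj : matrixForm T ξ (a.transpose.map star) = star (matrixForm T ξ a) := by
    rw [matrixForm_apply, matrixForm_apply, Finset.sum_comm]
    simp [hs, ContinuousLinearMap.adjoint_inner_right, star_sum]
  rw [hermitianDefect, map_sub, map_smul, map_smul, map_add, hd, hadj, Complex.star_def,
    Complex.add_conj]
  push_cast
  simp

end MatrixForm

theorem opMatrix_submatrix_map_isPositive {A ι κ : Type*} [AddCommGroup A] [Module ℂ A]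
    {H : Type u} [NormedAddCommGroup H] [InnerProductSpace ℂ H] [Fintype ι] [Fintype κ]
    (e : ι ≃ κ) (T : A →ₗ[ℂ] (H →L[ℂ] H)) (a : Matrix ι ι A) :
    (opMatrix ((a.submatrix e.symm e.symm).map T)).IsPositive ↔ ∀ ξ, 0 ≤ matrixForm T ξ a := by
  have h : (a.submatrix e.symm e.symm).map T = (a.map T).submatrix e.symm e.symm := rfl
  rw [h, opMatrix_reindex, opMatrix_isPositive_iff]
  rfl

/-! ### UCP maps on A(K) are point evaluations -/

namespace CompactNCConvexSet

variable {κ : Cardinal.{u}} {K : CompactNCConvexSet κ}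

instance (n : Level κ) : CompactSpace (K.points n) := by
  let _ := pointWeakStar K.predual.carrier (Hilb n)
  exact isCompact_iff_compactSpace.mp (K.isCompact n)

/-- Evaluation at a point of `K`, as a map on the operator system `A(K)`. -/
def evalMap (K : CompactNCConvexSet κ) (n : Level κ) (x : K.points n) :
    K.affineSystem.carrier →ₗ[ℂ] (Hilb n →L[ℂ] Hilb n) :=
  K.evalAt n x

theorem mem_cone_affineSystem {k : ℕ} {a : Matrix (Fin k) (Fin k) K.affineSystem.carrier} :
    a ∈ K.affineSystem.cone k ↔ ∀ n x, (opMatrix (a.map (K.evalMap n x))).IsPositive := Iff.rfl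

theorem isUCP_evalMap {n : Level κ} (x : K.points n) : IsUCP K.affineSystem (K.evalMap n x) :=
  ⟨rfl, fun _ _ ha => ha n x⟩

theorem continuous_inner_evalMap (n : Level κ) (a : K.affineSystem.carrier) (ξ η : Hilb n) :
    Continuous fun x : K.points n => ⟪η, K.evalMap n x a ξ⟫_ℂ := by
  have h := continuous_weakStar.mp (a.2.continuous_toFun n) (vecPair ξ η)
  simp_rw [pairing_vecPair] at h
  exact h

theorem inner_eq_sum_sum {ι E : Type*} [Fintype ι] [NormedAddCommGroup E] [InnerProductSpace ℂ E]
    (B : OrthonormalBasis ι ℂ E) (T : E →L[ℂ] E) (ξ η : E) : ⟪η, T ξ⟫_ℂ =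
      ∑ k, ∑ l, ⟪η, B k⟫_ℂ * ⟪B k, T (B l)⟫_ℂ * ⟪B l, ξ⟫_ℂ := by
  conv_lhs => rw [← B.sum_repr' ξ, ← B.sum_inner_mul_inner]
  refine Finset.sum_congr rfl fun k _ => ?_
  rw [map_sum, inner_sum, Finset.mul_sum]
  refine Finset.sum_congr rfl fun l _ => ?_
  rw [map_smul, inner_smul_right]
  ring

/-- Weak continuity of the operators does not in general give joint continuity in operator and
vectors. With a finite orthonormal basis the expression is a finite sum of products of continuous
functions. -/
theorem continuous_inner_apply {X ι E : Type*} [TopologicalSpace X] [Fintype ι]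
    [NormedAddCommGroup E] [InnerProductSpace ℂ E] (B : OrthonormalBasis ι ℂ E) {T : X → E →L[ℂ] E}
    (hT : ∀ k l, Continuous fun x => ⟪B k, T x (B l)⟫_ℂ) {ξ η : X → E} (hξ : Continuous ξ)
    (hη : Continuous η) : Continuous fun x => ⟪η x, T x (ξ x)⟫_ℂ := by
  simp only [fun x => inner_eq_sum_sum B (T x) (ξ x) (η x)]
  fun_prop

theorem continuous_inner_evalMap_pair (n : Level κ) [Fintype n.Index] (a : K.affineSystem.carrier)
    (i j : n.Index) :
    Continuous fun x : K.points n × (n.Index → Hilb n) =>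
      ⟪x.2 i, K.evalMap n x.1 a (x.2 j)⟫_ℂ :=
  continuous_inner_apply (Hilb.basis n).toOrthonormalBasis
    (fun _ _ => (continuous_inner_evalMap n a _ _).comp continuous_fst)
    ((continuous_apply j).comp continuous_snd) ((continuous_apply i).comp continuous_snd)

/-- Pairs of a point at a finite level and a normalized tuple of vectors. -/
abbrev VectorPoint (K : CompactNCConvexSet κ) (n : Level κ) [Fintype n.Index] : Type u :=
  K.points n × {ξ : n.Index → Hilb n | ∑ i, ‖ξ i‖ ^ 2 = Fintype.card n.Index}

/-- Norm compactness comes from the finite dimension of `Hilb n`; for this reason the separation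
argument runs at finite levels, and infinite levels are reached afterwards through finite corners.
-/
instance (n : Level κ) [Fintype n.Index] :
    CompactSpace {ξ : n.Index → Hilb n | ∑ i, ‖ξ i‖ ^ 2 = Fintype.card n.Index} := by
  have : FiniteDimensional ℂ (Hilb n) :=
    (Hilb.basis n).toOrthonormalBasis.toBasis.finiteDimensional_of_finite
  have : ProperSpace (Hilb n) := FiniteDimensional.proper ℂ _
  refine isCompact_iff_compactSpace.mp (Metric.isCompact_of_isClosed_isBounded
    (isClosed_eq (by fun_prop) continuous_const) ?_)
  refine (Metric.isBounded_closedBall (x := 0) (r := √(Fintype.card n.Index))).subset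
    fun ξ hξ => ?_
  rw [mem_closedBall_zero_iff, pi_norm_le_iff_of_nonneg (Real.sqrt_nonneg _)]
  intro i
  refine Real.le_sqrt_of_sq_le ?_
  rw [← Set.mem_ofPred_eq.mp hξ]
  exact Finset.single_le_sum (f := fun i => ‖ξ i‖ ^ 2) (fun _ _ => by positivity)
    (Finset.mem_univ i)

/-- The functional on matrices over `A(K)` given by a normalized tuple of vectors. -/
def vectorForm {n : Level κ} [Fintype n.Index] (x : K.VectorPoint n) :
    Matrix n.Index n.Index K.affineSystem.carrier →ₗ[ℂ] ℂ :=
  matrixForm (K.evalMap n x.1) x.2.1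

theorem continuous_vectorForm (n : Level κ) [Fintype n.Index]
    (a : Matrix n.Index n.Index K.affineSystem.carrier) :
    Continuous fun x : K.VectorPoint n => vectorForm x a := by
  refine continuous_finsetSum _ fun i _ => continuous_finsetSum _ fun j _ => ?_
  exact (continuous_inner_evalMap_pair n (a i j) i j).comp
    (continuous_fst.prodMk (continuous_subtype_val.comp continuous_snd))

theorem exists_vectorForm_eq_combination (hκ : Cardinal.aleph0 ≤ κ) {n : Level κ}
    [Fintype n.Index] (x y : K.VectorPoint n) {s t : ℝ} (hs : 0 ≤ s) (ht : 0 ≤ t)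
    (hst : s + t = 1) :
    ∃ z : K.VectorPoint n, vectorForm z = (s : ℂ) • vectorForm x + (t : ℂ) • vectorForm y := by
  obtain ⟨z, ζ, h⟩ := exists_point_of_pair hκ x.1 y.1 x.2.1 y.2.1 hs ht
  -- The normalization is itself a value of the form: at the constant function 1 the identity `h`
  -- says that squared norms combine convexly.
  have hζ : ∑ i, ‖ζ i‖ ^ 2 = Fintype.card n.Index := by
    have h1 : ∀ i, ‖ζ i‖ ^ 2 = s * ‖x.2.1 i‖ ^ 2 + t * ‖y.2.1 i‖ ^ 2 := fun i => by
      have h2 := h _ (IsContAffine.one K) i i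
      simp only [one_apply_eq_self, inner_self_eq_norm_sq_to_K] at h2
      simp only [Complex.coe_algebraMap] at h2
      exact_mod_cast h2
    have hx : ∑ i, ‖x.2.1 i‖ ^ 2 = (Fintype.card n.Index : ℝ) := x.2.2
    have hy : ∑ i, ‖y.2.1 i‖ ^ 2 = (Fintype.card n.Index : ℝ) := y.2.2
    simp_rw [h1, Finset.sum_add_distrib, ← Finset.mul_sum, hx, hy, ← add_mul, hst, one_mul]
  refine ⟨⟨z, ζ, hζ⟩, LinearMap.ext fun a => ?_⟩
  simp only [vectorForm, matrixForm_apply, LinearMap.add_apply, LinearMap.smul_apply,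
    smul_eq_mul, Finset.mul_sum, ← Finset.sum_add_distrib]
  exact Finset.sum_congr rfl fun i _ => Finset.sum_congr rfl fun j _ => h _ (a i j).2 i j

/-- An upper bound on all functionals given by normalized tuples of vectors at a finite level yields
a positive matrix over `A(K)`. -/
theorem hermitianDefect_mem_cone (hκ : Cardinal.aleph0 ≤ κ) {n : Level κ} [Fintype n.Index]
    [DecidableEq n.Index] {a : Matrix n.Index n.Index K.affineSystem.carrier} {c : ℝ}
    (h : ∀ x : K.VectorPoint n, (vectorForm x a).re ≤ c) {k : ℕ} (e : n.Index ≃ Fin k) :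
    (hermitianDefect (c / Fintype.card n.Index) a).submatrix e.symm e.symm
      ∈ K.affineSystem.cone k := by
  have hN : (0 : ℝ) < Fintype.card n.Index := by exact_mod_cast Fintype.card_pos
  refine mem_cone_affineSystem.mpr fun p x => ?_
  refine (opMatrix_submatrix_map_isPositive e _ _).mpr fun ξ => ?_
  -- Positivity has to be checked at every level `p`, but only as many vectors occur as level `n`
  -- has dimensions, so they can be moved to level `n`, where the bound is assumed.
  obtain ⟨z, ζ, hζ⟩ := exists_point_of_vectors hκ x ξ
  have h1 : matrixForm (K.evalMap p x) ξ (hermitianDefect (c / Fintype.card n.Index) a)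
      = matrixForm (K.evalMap n z) ζ (hermitianDefect (c / Fintype.card n.Index) a) :=
    Finset.sum_congr rfl fun i _ => Finset.sum_congr rfl fun j _ =>
      (hζ _ (hermitianDefect (c / Fintype.card n.Index) a i j).2 i j).symm
  have h0 := matrixForm_hermitianDefect (isUCP_evalMap z).1 (isUCP_evalMap z).map_star ζ
    (c / Fintype.card n.Index) a
  refine le_of_le_of_eq (Complex.zero_le_real.mpr ?_) (h1.trans h0).symm
  set R := ∑ i, ‖ζ i‖ ^ 2 with hR
  have hR0 : 0 ≤ R := Finset.sum_nonneg fun i _ => by positivity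
  rcases hR0.eq_or_lt with hR1 | hR1
  · have h2 : ∀ i, ζ i = 0 := fun i => by
      have h3 := (Finset.sum_eq_zero_iff_of_nonneg fun i _ => by positivity).mp hR1.symm i
        (Finset.mem_univ i)
      simpa using h3
    rw [← hR1, matrixForm_apply]
    simp [h2]
  · have hr : (0 : ℝ) ≤ Fintype.card n.Index / R := by positivity
    -- Rescaling by √(N/R), with N the dimension of level `n`, brings the total squared norm from R
    -- to N.
    have h2 := h ⟨z, fun i => ((√(Fintype.card n.Index / R) : ℝ) : ℂ) • ζ i, by
      simp only [Set.mem_ofPred_eq, norm_smul, mul_pow, Complex.norm_real, Real.norm_eq_abs,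
        sq_abs, Real.sq_sqrt hr, ← Finset.mul_sum]
      rw [← hR]
      field_simp⟩
    replace h2 := (congrArg Complex.re (matrixForm_smul (K.evalMap n z) ζ _ a)).symm.trans_le h2
    rw [Complex.re_ofReal_mul, Real.sq_sqrt hr] at h2
    rw [div_mul_eq_mul_div, sub_nonneg, le_div_iff₀ hN]
    rw [div_mul_eq_mul_div, div_le_iff₀ hR1] at h2
    linarith

/-- Corners of unital completely positive maps on `A(K)` are corners of evaluations. -/
theorem exists_vectorForm_eq (hκ : Cardinal.aleph0 ≤ κ) {H : Type u} [NormedAddCommGroup H]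
    [InnerProductSpace ℂ H] [CompleteSpace H] {φ : K.affineSystem.carrier →ₗ[ℂ] (H →L[ℂ] H)}
    (hφ : IsUCP K.affineSystem φ) (n : Level κ) [Fintype n.Index] {e : n.Index → H}
    (he : Orthonormal ℂ e) : ∃ x : K.VectorPoint n, vectorForm x = matrixForm φ e := by
  classical
  by_contra! hne
  -- The separating matrix has real part at most `c` on all normalized tuples, so (c/N)·1 − Re a is
  -- positive over A(K). Applying `φ` and testing on `e`, whose total squared norm is N, contradicts
  -- `h2`.
  obtain ⟨a, c, h1, h2⟩ := exists_separating_vector vectorForm (continuous_vectorForm n)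
    (fun x y s t hs ht hst => exists_vectorForm_eq_combination hκ x y hs ht hst) _ hne
  have h3 := hφ.2 _ _ (hermitianDefect_mem_cone hκ h1 (Fintype.equivFin n.Index))
  have h4 := (opMatrix_submatrix_map_isPositive _ φ _).mp h3 e
  have h5 := matrixForm_hermitianDefect hφ.1 hφ.map_star e (c / Fintype.card n.Index) a
  rw [h5, Complex.zero_le_real] at h4
  simp only [he.1, one_pow, Finset.sum_const, Finset.card_univ, nsmul_eq_mul, mul_one] at h4
  rw [div_mul_cancel₀ _ (by exact_mod_cast Fintype.card_ne_zero)] at h4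
  linarith

/-- The corner over `F` is first realized by vectors at the level of dimension |F|. Comparing values
at 1 shows these vectors to be orthonormal, so the corner can be placed at level `n`, which may be
infinite. -/
theorem exists_point_of_finset (hκ : Cardinal.aleph0 ≤ κ) {n : Level κ}
    {φ : K.affineSystem.carrier →ₗ[ℂ] (Hilb n →L[ℂ] Hilb n)} (hφ : IsUCP K.affineSystem φ)
    (F : Finset n.Index) (hF : F.Nonempty) :
    ∃ z : K.points n, ∀ a, ∀ i ∈ F, ∀ j ∈ F,
      ⟪Hilb.basis n i, K.evalMap n z a (Hilb.basis n j)⟫_ℂ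
        = ⟪Hilb.basis n i, φ a (Hilb.basis n j)⟫_ℂ := by
  classical
  have : Nonempty F := hF.to_subtype
  obtain ⟨m, ⟨g⟩⟩ := Level.exists_equiv (κ := κ) F
    ((Cardinal.lt_aleph0_of_finite _).le.trans hκ)
  let _ : Fintype m.Index := Fintype.ofEquiv F g
  obtain ⟨x, hx⟩ := exists_vectorForm_eq hκ hφ m (e := fun i => Hilb.basis n (g.symm i))
    ((Hilb.basis n).orthonormal.comp _ (Subtype.val_injective.comp g.symm.injective))
  have hx' : ∀ (a : K.affineSystem.carrier) i j, ⟪x.2.1 i, K.evalMap m x.1 a (x.2.1 j)⟫_ℂ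
      = ⟪Hilb.basis n (g.symm i), φ a (Hilb.basis n (g.symm j))⟫_ℂ := fun a i j => by
    rw [← matrixForm_single]
    refine (congrArg (fun θ => θ (Matrix.single i j a)) hx).trans ?_
    exact matrixForm_single _ _ _ _ _
  let b : n.Index → Hilb m := fun k => if h : k ∈ F then x.2.1 (g ⟨k, h⟩) else 0
  obtain ⟨z, hz⟩ := exists_point_of_orthonormal hκ x.1 F b (by
    rw [orthonormal_iff_ite]
    rintro ⟨i, hi⟩ ⟨j, hj⟩
    have h := hx' (1 : K.affineSystem.carrier) (g ⟨i, hi⟩) (g ⟨j, hj⟩)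
    rw [hφ.1, (isUCP_evalMap x.1).1] at h
    simp only [one_apply_eq_self, Equiv.symm_apply_apply,
      orthonormal_iff_ite.mp (Hilb.basis n).orthonormal] at h
    have hi' : i ∈ F := hi
    have hj' : j ∈ F := hj
    simpa [b, hi', hj'] using h)
  refine ⟨z, fun a i hi j hj => ?_⟩
  refine (hz a.1 a.2 i hi j hj).trans ?_
  have h := hx' a (g ⟨i, hi⟩) (g ⟨j, hj⟩)
  simp only [Equiv.symm_apply_apply] at h
  simp only [b, hi, hj, dif_pos]
  exact h

/-- Every unital completely positive map on `A(K)` at level `n` is the evaluation at a point. -/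
theorem exists_evalMap_eq (hκ : Cardinal.aleph0 ≤ κ) {n : Level κ}
    {φ : K.affineSystem.carrier →ₗ[ℂ] (Hilb n →L[ℂ] Hilb n)} (hφ : IsUCP K.affineSystem φ) :
    ∃ x : K.points n, K.evalMap n x = φ := by
  classical
  -- Each matrix coefficient imposes a closed condition on the point. Finitely many coefficients
  -- involve a finite corner only, so the conditions have the finite intersection property.
  obtain ⟨x, hx⟩ := CompactSpace.iInter_nonempty (X := K.points n)
    (t := fun q : K.affineSystem.carrier × n.Index × n.Index =>
      {x | ⟪Hilb.basis n q.2.1, K.evalMap n x q.1 (Hilb.basis n q.2.2)⟫_ℂ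
        = ⟪Hilb.basis n q.2.1, φ q.1 (Hilb.basis n q.2.2)⟫_ℂ})
    (fun q => isClosed_eq (continuous_inner_evalMap n q.1 _ _) continuous_const)
    (fun Q => by
      -- The arbitrary index keeps the corner nonempty when `Q` is empty, since there is no level of
      -- dimension zero.
      obtain ⟨z, hz⟩ := exists_point_of_finset hκ hφ
        (insert (Classical.arbitrary _) (Q.image (fun q => q.2.1) ∪ Q.image (fun q => q.2.2)))
        (Finset.insert_nonempty _ _)
      refine ⟨z, Set.mem_iInter₂.mpr fun q hq => hz _ _ ?_ _ ?_⟩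
      · exact Finset.mem_insert_of_mem (Finset.mem_union_left _ (Finset.mem_image_of_mem _ hq))
      · exact Finset.mem_insert_of_mem (Finset.mem_union_right _ (Finset.mem_image_of_mem _ hq)))
  refine ⟨x, LinearMap.ext fun a => clm_ext_hilbertBasis (Hilb.basis n) fun j =>
    ext_inner_hilbertBasis (Hilb.basis n) fun i => ?_⟩
  exact Set.mem_iInter.mp hx (a, i, j)

/-! ### Isomorphism of K with the nc state space of A(K) -/

/-- The predual thus supplies enough functions in A(K) to determine the points of K and their
topology. -/
theorem isContAffine_predual (v : K.predual.carrier) :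
    K.IsContAffine fun _ x => x.1 v where
  map_sum _ _ _ _ _ _ _ _ h := pointWeakStarHasSum_iff.mp h v
  map_compress _ _ _ _ _ := rfl
  continuous_toFun n := continuous_weakStar.mpr fun p =>
    (@continuous_pointWeakStar _ _ _ K.predual.carrier _ _ _ (K.levelTopology n) Subtype.val).mp
      (@continuous_induced_dom _ _ Subtype.val (pointWeakStar _ _)) v p

/-- The elements of the predual, as continuous affine nc functions. -/
def predualEval (K : CompactNCConvexSet κ) : K.predual.carrier →ₗ[ℂ] K.affineSystem.carrier :=
  show K.predual.carrier →ₗ[ℂ] K.affineSubmodule from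
  { toFun := fun v => ⟨fun _ x => x.1 v, isContAffine_predual v⟩
    map_add' := fun v w => by ext n x : 3; exact map_add x.1 v w
    map_smul' := fun c v => by ext n x : 3; exact map_smul x.1 c v }

theorem affineSystem_ext {a b : K.affineSystem.carrier}
    (h : ∀ n x, K.evalMap n x a = K.evalMap n x b) : a = b :=
  Subtype.ext (funext fun n => funext fun x => h n x)

/-- Evaluation at the points of `K`, as a continuous affine nc map into the nc state space of
`A(K)`. -/
def evalAffine (K : CompactNCConvexSet κ) : AffineMap K (stateSpace κ K.affineSystem) where
  toFun n x := ⟨K.evalMap n x, isUCP_evalMap x⟩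
  map_sum I lev n x α y hb hα hy :=
    pointWeakStarHasSum_iff.mpr fun a => a.2.map_sum I lev n x α y hb hα hy
  map_compress m n β hβ x := LinearMap.ext fun a => a.2.map_compress m n β hβ x
  continuous_toFun n := continuous_induced_rng.mpr (continuous_pointWeakStar.mpr fun a p =>
    continuous_weakStar.mp (a.2.continuous_toFun n) p)

/-- The point of `K` at which a state of `A(K)` is the evaluation. -/
def statePoint (hκ : Cardinal.aleph0 ≤ κ) (n : Level κ)
    (y : (stateSpace κ K.affineSystem).points n) : K.points n :=
  (exists_evalMap_eq hκ (φ := y.1) y.2).choose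

theorem evalMap_statePoint (hκ : Cardinal.aleph0 ≤ κ) (n : Level κ)
    (y : (stateSpace κ K.affineSystem).points n) : K.evalMap n (statePoint hκ n y) = y.1 :=
  (exists_evalMap_eq hκ (φ := y.1) y.2).choose_spec

/-- The coordinates of the chosen point are values of the given state, so the choice disappears:
affinity and continuity of the inverse are read off coordinate by coordinate. -/
theorem statePoint_apply (hκ : Cardinal.aleph0 ≤ κ) (n : Level κ)
    (y : (stateSpace κ K.affineSystem).points n) (v : K.predual.carrier) :
    (statePoint hκ n y).1 v = y.1 (K.predualEval v) := by
  rw [← evalMap_statePoint hκ n y]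
  rfl

/-- The inverse of the evaluation map from `K` to the nc state space of `A(K)`. -/
def evalAffineInv (hκ : Cardinal.aleph0 ≤ κ) (K : CompactNCConvexSet κ) :
    AffineMap (stateSpace κ K.affineSystem) K where
  toFun n y := statePoint hκ n y
  map_sum I lev n x α y _ hα hy := by
    rw [pointWeakStarHasSum_sandwich_iff hα] at hy ⊢
    intro v i ζ
    rw [statePoint_apply, statePoint_apply]
    exact hy (K.predualEval v) i ζ
  map_compress m n β hβ x := LinearMap.ext fun v => by
    rw [statePoint_apply]
    change _ = adjoint β ∘L (statePoint hκ n x).1 v ∘L β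
    rw [statePoint_apply]
    rfl
  continuous_toFun n := by
    refine continuous_induced_rng.mpr (continuous_pointWeakStar.mpr fun v p => ?_)
    have h : ∀ y : (stateSpace κ K.affineSystem).points n,
        pairing p ((statePoint hκ n y).1 v) = pairing p (y.1 (K.predualEval v)) :=
      fun y => by rw [statePoint_apply]
    refine (continuous_congr h).mpr ?_
    exact continuous_weakStar.mp (isContAffine_predual (K := stateSpace κ K.affineSystem)
      (K.predualEval v) |>.continuous_toFun n) p

/-- A compact nc convex set is isomorphic to the nc state space of `A(K)`. -/
def evalIso (hκ : Cardinal.aleph0 ≤ κ) (K : CompactNCConvexSet κ) :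
    K ≅ stateSpace κ K.affineSystem where
  hom := K.evalAffine
  inv := evalAffineInv hκ K
  hom_inv_id := AffineMap.ext (funext fun n => funext fun x => Subtype.ext (LinearMap.ext fun v =>
    statePoint_apply hκ n (K.evalAffine.toFun n x) v))
  inv_hom_id := AffineMap.ext (funext fun n => funext fun y =>
    Subtype.ext (evalMap_statePoint hκ n y))

/-- The natural isomorphism between a compact nc convex set and the nc state space of `A(K)`. -/
def evalNatIso (hκ : Cardinal.aleph0 ≤ κ) :
    affineFunctor κ ⋙ stateFunctor κ ≅ 𝟭 (CompactNCConvexSet κ)ᵒᵖ :=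
  NatIso.ofComponents (fun K => (evalIso hκ K.unop).op) fun _ => rfl

end CompactNCConvexSet

/-! ### Order embedding and injectivity of s ↦ ŝ -/

variable {κ : Cardinal.{u}}

/-- Finitely many vectors, not all zero, lie in the range of an isometry defined on a level. -/
theorem exists_isometry_of_vectors (hκ : Cardinal.aleph0 ≤ κ) {H : Type u} [NormedAddCommGroup H]
    [InnerProductSpace ℂ H] [CompleteSpace H] {ι : Type*} [Finite ι] (ξ : ι → H)
    (hξ : ∃ i, ξ i ≠ 0) :
    ∃ (n : Level κ) (β : Hilb n →ₗᵢ[ℂ] H) (ζ : ι → Hilb n), ∀ i, β (ζ i) = ξ i := by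
  let U := Submodule.span ℂ (Set.range ξ)
  have : FiniteDimensional ℂ U := FiniteDimensional.span_of_finite ℂ (Set.finite_range ξ)
  have hmem : ∀ i, ξ i ∈ U := fun i => Submodule.subset_span ⟨i, rfl⟩
  let B := stdOrthonormalBasis ℂ U
  obtain ⟨i, hi⟩ := hξ
  have : Nontrivial U := ⟨⟨⟨ξ i, hmem i⟩, 0, fun h => hi (congrArg Subtype.val h)⟩⟩
  have : Nonempty (Fin (Module.finrank ℂ U)) := ⟨⟨0, Module.finrank_pos⟩⟩
  obtain ⟨n, ⟨g⟩⟩ := Level.exists_equiv (κ := κ) (ULift.{u} (Fin (Module.finrank ℂ U)))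
    ((Cardinal.lt_aleph0_of_finite _).le.trans hκ)
  have hort : Orthonormal ℂ fun k : n.Index => (B (g.symm k).down : H) :=
    (B.orthonormal.comp_linearIsometry U.subtypeₗᵢ).comp _
      (ULift.down_injective.comp g.symm.injective)
  obtain ⟨β, hβ⟩ := exists_isometry_of_orthonormal hort
  refine ⟨n, β, fun i => ∑ l, B.repr ⟨ξ i, hmem i⟩ l • Hilb.basis n (g ⟨l⟩), fun i => ?_⟩
  have h := congrArg Subtype.val (B.sum_repr ⟨ξ i, hmem i⟩)
  simpa [hβ] using h

theorem IsUCP.compress {S : OperatorSystem.{u}} {G H : Type u} [NormedAddCommGroup G]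
    [InnerProductSpace ℂ G] [CompleteSpace G] [NormedAddCommGroup H] [InnerProductSpace ℂ H]
    [CompleteSpace H] {φ : S.carrier →ₗ[ℂ] (H →L[ℂ] H)} (hφ : IsUCP S φ) (β : G →ₗᵢ[ℂ] H) :
    IsUCP S (sandwich (adjoint β.toContinuousLinearMap) φ β.toContinuousLinearMap) := by
  refine ⟨?_, fun k a ha => opMatrix_conj_isPositive _ _ (hφ.2 k a ha)⟩
  change adjoint _ ∘L φ 1 ∘L _ = 1
  rw [hφ.1]
  exact adjoint_comp_linearIsometry β

theorem norm_opMatrix_one_le {H : Type u} [NormedAddCommGroup H] [InnerProductSpace ℂ H]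
    (T : H →L[ℂ] H) :
    ‖opMatrix (fun _ _ : Fin 1 => T : Matrix (Fin 1) (Fin 1) (H →L[ℂ] H))‖ ≤ ‖T‖ := by
  refine ContinuousLinearMap.opNorm_le_bound _ (norm_nonneg _) fun ξ => ?_
  have hn : ∀ ζ : PiLp 2 (fun _ : Fin 1 => H), ‖ζ‖ = ‖ζ 0‖ := fun ζ => by
    rw [PiLp.norm_eq_of_L2]
    simp
  have h := opMatrix_apply (fun _ _ : Fin 1 => T) ξ 0
  rw [Fin.sum_univ_one] at h
  rw [hn, hn]
  exact (congrArg norm h).trans_le (T.le_opNorm _)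

namespace OperatorSystem

variable (S : OperatorSystem.{u})

/-- The canonical map `s ↦ ŝ` from an operator system to the continuous affine nc functions on its
nc state space. -/
def hat (κ : Cardinal.{u}) : S.carrier →ₗ[ℂ] (stateSpace κ S).affineSystem.carrier :=
  (stateSpace κ S).predualEval

theorem evalMap_hat (n : Level κ) (x : (stateSpace κ S).points n) (s : S.carrier) :
    (stateSpace κ S).evalMap n x (S.hat κ s) = x.1 s := rfl

theorem hat_one : S.hat κ 1 = 1 :=
  CompactNCConvexSet.affineSystem_ext fun _ x => x.2.1

theorem hat_star (s : S.carrier) : S.hat κ (star s) = star (S.hat κ s) :=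
  CompactNCConvexSet.affineSystem_ext fun n x => by
    rw [(CompactNCConvexSet.isUCP_evalMap x).map_star]
    exact IsUCP.map_star x.2 s

/-- In a concrete representation, positivity of an m × m matrix is tested on m vectors at a time.
Compressing the representation to their span gives a point of the nc state space, where positivity
is known. -/
theorem mem_cone_iff (hκ : Cardinal.aleph0 ≤ κ) {m : ℕ} (a : Matrix (Fin m) (Fin m) S.carrier) :
    a ∈ S.cone m ↔ a.map (S.hat κ) ∈ (stateSpace κ S).affineSystem.cone m := by
  refine ⟨fun ha n x => x.2.2 m a ha, fun ha => ?_⟩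
  obtain ⟨H, _, _, _, ι, -, -, h1, -, hc, -⟩ := S.exists_rep
  rw [hc, opMatrix_isPositive_iff]
  intro ξ
  -- The zero tuple spans no level and is treated apart.
  by_cases hξ : ∃ i, ξ i ≠ 0
  · obtain ⟨n, β, ζ, hβ⟩ := exists_isometry_of_vectors hκ ξ hξ
    have hx : IsUCP S ι := ⟨h1, fun k b hb => (hc k b).mp hb⟩
    have h2 := (opMatrix_isPositive_iff _).mp (ha n ⟨_, hx.compress β⟩) ζ
    refine h2.trans_eq (Finset.sum_congr rfl fun i _ => Finset.sum_congr rfl fun j _ => ?_)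
    change ⟪ζ i, adjoint _ (ι (a i j) (β (ζ j)))⟫_ℂ = _
    rw [ContinuousLinearMap.adjoint_inner_right, ← hβ, ← hβ]
    rfl
  · push Not at hξ
    simp [hξ]

/-- Compressing to the span of a single vector bounds the numerical radius of `φ s`. The factor 4 is
the price of polarization and does no harm, as only injectivity and Cauchy estimates depend on it.
-/
theorem norm_rep_le (hκ : Cardinal.aleph0 ≤ κ) {H : Type u} [NormedAddCommGroup H]
    [InnerProductSpace ℂ H] [CompleteSpace H] {φ : S.carrier →ₗ[ℂ] (H →L[ℂ] H)} (hφ : IsUCP S φ)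
    {s : S.carrier} {C : ℝ} (hC : 0 ≤ C)
    (h : ∀ (n : Level κ) (x : (stateSpace κ S).points n), ‖x.1 s‖ ≤ C) : ‖φ s‖ ≤ 4 * C := by
  refine opNorm_le_of_numericalRadius _ hC fun ξ => ?_
  by_cases hξ : ξ = 0
  · simp [hξ]
  obtain ⟨n, β, ζ, hβ⟩ := exists_isometry_of_vectors hκ (fun _ : Unit => ξ) ⟨(), hξ⟩
  obtain rfl := hβ ()
  have h1 := h n ⟨_, hφ.compress β⟩
  have h2 : ⟪β (ζ ()), φ s (β (ζ ()))⟫_ℂ = ⟪ζ (), (sandwich (adjoint β.toContinuousLinearMap) φ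
      β.toContinuousLinearMap s) (ζ ())⟫_ℂ :=
    (ContinuousLinearMap.adjoint_inner_right β.toContinuousLinearMap (ζ ())
      (φ s (β (ζ ())))).symm
  rw [h2, β.norm_map]
  refine (norm_inner_le_norm _ _).trans ?_
  rw [mul_comm, sq, ← mul_assoc]
  gcongr
  exact ContinuousLinearMap.le_of_opNorm_le _ h1 _

theorem hat_injective (hκ : Cardinal.aleph0 ≤ κ) : Function.Injective (S.hat κ) := by
  refine (injective_iff_map_eq_zero _).mpr fun s hs => ?_
  obtain ⟨H, _, _, _, ι, hι, -, h1, -, hc, -⟩ := S.exists_rep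
  have h := S.norm_rep_le hκ (φ := ι) ⟨h1, fun k b hb => (hc k b).mp hb⟩ (s := s) le_rfl
    fun n x => by rw [← evalMap_hat, hs, map_zero, norm_zero]
  rw [mul_zero, norm_le_zero_iff] at h
  exact hι (h.trans (map_zero ι).symm)

end OperatorSystem

/-! ### States at a one-dimensional level -/

namespace CompactNCConvexSet

variable {K : CompactNCConvexSet κ} {n : Level κ} [Unique n.Index]

/-- The state of `A(K)` given by a normalized vector at a one-dimensional level. -/
def vectorState (x : K.VectorPoint n) : K.affineSystem.carrier →ₗ[ℂ] ℂ :=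
  vectorForm x ∘ₗ Matrix.singleLinearMap ℂ default default

theorem vectorState_apply (x : K.VectorPoint n) (a : K.affineSystem.carrier) :
    vectorState x a = ⟪x.2.1 default, K.evalMap n x.1 a (x.2.1 default)⟫_ℂ :=
  matrixForm_single (K.evalMap n x.1) x.2.1 default default a

theorem norm_vector_eq_one (x : K.VectorPoint n) : ‖x.2.1 default‖ = 1 := by
  have h : ∑ i, ‖x.2.1 i‖ ^ 2 = (Fintype.card n.Index : ℝ) := x.2.2
  have h1 : (Fintype.card n.Index : ℝ) = 1 := by rw [Fintype.card_unique, Nat.cast_one]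
  rw [Fintype.sum_unique] at h
  exact (pow_eq_one_iff_of_nonneg (norm_nonneg _) two_ne_zero).mp (h.trans h1)

theorem vectorState_one (x : K.VectorPoint n) : vectorState x 1 = 1 := by
  rw [vectorState_apply, (isUCP_evalMap x.1).1, one_apply_eq_self, inner_self_eq_norm_sq_to_K,
    norm_vector_eq_one]
  simp

theorem vectorState_star (x : K.VectorPoint n) (a : K.affineSystem.carrier) :
    vectorState x (star a) = star (vectorState x a) := by
  rw [vectorState_apply, vectorState_apply, (isUCP_evalMap x.1).map_star,
    ContinuousLinearMap.adjoint_inner_right, Complex.star_def, inner_conj_symm]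

theorem continuous_vectorState (a : K.affineSystem.carrier) :
    Continuous fun x : K.VectorPoint n => vectorState x a :=
  continuous_vectorForm n _

/-- Vector states are evaluations at points of the one-dimensional level. -/
theorem exists_point_of_vectorState (x : K.VectorPoint n) : ∃ z : K.points n,
    (∀ a, vectorState x a
      = ⟪Hilb.basis n default, K.evalMap n z a (Hilb.basis n default)⟫_ℂ) := by
  obtain ⟨β, hβ⟩ := exists_isometry_of_orthonormal (n := n) (v := x.2.1)
    ⟨fun i => by rw [Unique.eq_default i]; exact norm_vector_eq_one x,
      fun i j hij => (hij (Subsingleton.elim i j)).elim⟩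
  have hβ1 := adjoint_comp_linearIsometry β
  refine ⟨⟨_, K.compress_mem n n _ hβ1 x.1.1 x.1.2⟩, fun a => ?_⟩
  have h : K.evalMap n ⟨_, K.compress_mem n n _ hβ1 x.1.1 x.1.2⟩ a
      = adjoint β.toContinuousLinearMap ∘L K.evalMap n x.1 a ∘L β.toContinuousLinearMap :=
    a.2.map_compress n n _ hβ1 x.1
  rw [h, ContinuousLinearMap.comp_apply, ContinuousLinearMap.comp_apply,
    ContinuousLinearMap.adjoint_inner_right, vectorState_apply, ← hβ]
  rfl

/-- States at the one-dimensional level are determined by their values on the predual. -/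
theorem vectorState_eq {x y : K.VectorPoint n}
    (h : ∀ v, vectorState x (K.predualEval v) = vectorState y (K.predualEval v)) :
    vectorState x = vectorState y := by
  obtain ⟨z, hz⟩ := exists_point_of_vectorState x
  obtain ⟨w, hw⟩ := exists_point_of_vectorState y
  -- At a one-dimensional level an operator is its single matrix coefficient, so equal values on the
  -- predual give the same point of K.
  have hzw : z = w := by
    refine Subtype.ext (LinearMap.ext fun v => clm_ext_hilbertBasis (Hilb.basis n) fun j =>
      ext_inner_hilbertBasis (Hilb.basis n) fun i => ?_)
    rw [Unique.eq_default i, Unique.eq_default j]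
    have h1 := h v
    rw [hz, hw] at h1
    exact h1
  refine LinearMap.ext fun a => ?_
  rw [hz, hw, hzw]

/-- The norm of a continuous affine nc function is controlled by its one-dimensional values. -/
theorem norm_evalMap_le (hκ : Cardinal.aleph0 ≤ κ) {a : K.affineSystem.carrier} {C : ℝ}
    (hC : 0 ≤ C) (h : ∀ x : K.VectorPoint n, ‖vectorState x a‖ ≤ C) (p : Level κ)
    (x : K.points p) : ‖K.evalMap p x a‖ ≤ 4 * C := by
  refine opNorm_le_of_numericalRadius _ hC fun ξ => ?_
  by_cases hξ : ξ = 0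
  · simp [hξ]
  have hξ' : 0 < ‖ξ‖ := norm_pos_iff.mpr hξ
  -- A vector state at any level is a vector state at the one-dimensional level; the value at 1
  -- shows that the new vector is again a unit vector.
  obtain ⟨z, ζ, hζ⟩ := exists_point_of_vectors hκ x fun _ : n.Index => ((‖ξ‖⁻¹ : ℝ) : ℂ) • ξ
  have h1 : ‖ζ default‖ = 1 := by
    have h2 := hζ _ (IsContAffine.one K) default default
    simp only [one_apply_eq_self, inner_self_eq_norm_sq_to_K, norm_smul, Complex.norm_real,
      norm_inv, norm_norm, inv_mul_cancel₀ hξ'.ne', Complex.coe_algebraMap] at h2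
    have h3 : ‖ζ default‖ ^ 2 = 1 := by
      rw [Complex.ofReal_one, one_pow] at h2
      exact_mod_cast h2
    exact (pow_eq_one_iff_of_nonneg (norm_nonneg _) two_ne_zero).mp h3
  have h2 := h ⟨z, ζ, by simp [h1]⟩
  rw [vectorState_apply] at h2
  have h3 : ⟪ζ default, K.evalMap n z a (ζ default)⟫_ℂ = ⟪((‖ξ‖⁻¹ : ℝ) : ℂ) • ξ,
      K.evalMap p x a (((‖ξ‖⁻¹ : ℝ) : ℂ) • ξ)⟫_ℂ := hζ a.1 a.2 default default
  have h4 := h3.symm ▸ h2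
  rw [map_smul, inner_smul_left, inner_smul_right, norm_mul, norm_mul] at h4
  simp only [RCLike.norm_conj, Complex.norm_real, norm_inv, norm_norm] at h4
  rw [← mul_assoc, ← mul_inv, inv_mul_le_iff₀ (by positivity)] at h4
  calc _ ≤ _ := h4
    _ = _ := by ring

end CompactNCConvexSet

/-! ### Surjectivity of s ↦ ŝ -/

open CompactNCConvexSet

namespace OperatorSystem

variable (S : OperatorSystem.{u})

/-- Self-adjoint continuous affine nc functions on the nc state space are uniformly approximated by
elements of the operator system on the one-dimensional level. -/
theorem exists_hat_approx (hκ : Cardinal.aleph0 ≤ κ) {n : Level κ} [Unique n.Index]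
    {f : (stateSpace κ S).affineSystem.carrier} (hf : star f = f) {ε : ℝ} (hε : 0 < ε) :
    ∃ h : S.carrier, ∀ x : (stateSpace κ S).VectorPoint n, ‖vectorState x (f - S.hat κ h)‖ ≤ ε := by
  rcases isEmpty_or_nonempty ((stateSpace κ S).VectorPoint n) with hemp | ⟨⟨y₀⟩⟩
  · exact ⟨0, fun x => hemp.elim x⟩
  -- For states x, y consider the functional (s, r) ↦ (x − y)(ŝ + r f). None of these equals (s, r)
  -- ↦ ε r: such x and y would agree on S, hence on f, although their values at f differ by ε.
  -- Separation yields s and r for which the real part of ŝ + r f oscillates by less than ε Re r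
  -- over all states.
  let T : S.carrier × ℂ →ₗ[ℂ] (stateSpace κ S).affineSystem.carrier :=
    (S.hat κ).coprod (LinearMap.toSpanSingleton ℂ _ f)
  obtain ⟨⟨s, r⟩, c, h1, h2⟩ := exists_separating_vector
    (X := (stateSpace κ S).VectorPoint n × (stateSpace κ S).VectorPoint n)
    (fun x => (vectorState x.1 - vectorState x.2) ∘ₗ T)
    (fun w => ((continuous_vectorState (T w)).comp continuous_fst).sub
      ((continuous_vectorState (T w)).comp continuous_snd))
    (fun x y s t hs ht hst => by
      obtain ⟨z₁, hz₁⟩ := exists_vectorForm_eq_combination hκ x.1 y.1 hs ht hst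
      obtain ⟨z₂, hz₂⟩ := exists_vectorForm_eq_combination hκ x.2 y.2 hs ht hst
      refine ⟨(z₁, z₂), LinearMap.ext fun w => ?_⟩
      simp only [vectorState, hz₁, hz₂, LinearMap.comp_apply, LinearMap.sub_apply,
        LinearMap.add_apply, LinearMap.smul_apply, smul_eq_mul]
      ring)
    ((ε : ℂ) • LinearMap.snd ℂ S.carrier ℂ) (fun x hx => by
      have h3 : vectorState x.1 = vectorState x.2 := vectorState_eq fun v => by
        have h4 := congrArg (fun θ => θ (v, 0)) hx
        simp only [T, LinearMap.comp_apply, LinearMap.coprod_apply, map_zero, add_zero,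
          LinearMap.sub_apply, LinearMap.smul_apply, LinearMap.snd_apply, smul_zero] at h4
        exact sub_eq_zero.mp h4
      have h4 := congrArg (fun θ => θ (0, 1)) hx
      rw [h3, sub_self, LinearMap.zero_comp] at h4
      have h5 : (0 : ℂ) = ε := by simpa using h4
      exact hε.ne (by exact_mod_cast h5))
  let a := T (s, r)
  have ha : a = S.hat κ s + r • f := by simp [a, T]
  have hsa : star a = S.hat κ (star s) + star r • f := by
    rw [ha, star_add, star_smul, hf, hat_star]
  have h3 : ∀ x y : (stateSpace κ S).VectorPoint n,
      (vectorState x a).re - (vectorState y a).re ≤ c := fun x y => h1 (x, y)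
  have h4 : c < ε * r.re := by simpa using h2
  have hρ : 0 < r.re := by
    have h5 := h3 y₀ y₀
    rw [sub_self] at h5
    exact pos_of_mul_pos_right (h5.trans_lt h4) hε.le
  -- Every state has Re a within ε Re r of `C`. As f is self-adjoint, Re a = Re ŝ + (Re r) f;
  -- replacing Re a by `C` and solving for f gives the approximant (C − Re s)/Re r.
  let C : ℝ := (vectorState y₀ a).re
  refine ⟨((r.re⁻¹ : ℝ) : ℂ) • ((C : ℂ) • 1 - (2⁻¹ : ℂ) • (s + star s)), fun x => ?_⟩
  have h5 : f - S.hat κ (((r.re⁻¹ : ℝ) : ℂ) • ((C : ℂ) • 1 - (2⁻¹ : ℂ) • (s + star s)))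
      = ((r.re⁻¹ : ℝ) : ℂ) • ((2⁻¹ : ℂ) • (a + star a) - (C : ℂ) • 1) := by
    have h6 : f = (((r.re⁻¹ : ℝ) : ℂ) * (2⁻¹ * (r + star r))) • f := by
      rw [Complex.star_def, Complex.add_conj]
      have h7 : ((r.re : ℝ) : ℂ) ≠ 0 := by exact_mod_cast hρ.ne'
      push_cast
      field_simp
      rw [one_smul]
    rw [hsa, ha]
    simp only [map_smul, map_sub, map_add, hat_one]
    conv_lhs => rw [h6]
    module
  rw [h5, map_smul, map_sub, map_smul, map_smul, map_add, vectorState_star, vectorState_one,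
    Complex.star_def, Complex.add_conj]
  have h6 : (2⁻¹ : ℂ) • ((2 * (vectorState x a).re : ℝ) : ℂ) - (C : ℂ) • (1 : ℂ)
      = (((vectorState x a).re - C : ℝ) : ℂ) := by
    push_cast
    simp
  rw [h6, smul_eq_mul, ← Complex.ofReal_mul, Complex.norm_real, Real.norm_eq_abs, abs_mul,
    abs_of_pos (inv_pos.mpr hρ), inv_mul_le_iff₀ hρ, mul_comm]
  exact (abs_le.mpr ⟨by linarith [h3 y₀ x], h3 x y₀⟩).trans h4.le

theorem norm_apply_le_norm_rep {H : Type u} [NormedAddCommGroup H] [InnerProductSpace ℂ H]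
    {ι : S.carrier →ₗ[ℂ] (H →L[ℂ] H)} (hι : IsCompletelyIsometric S.mnorm ι) {n : Level κ}
    (x : (stateSpace κ S).points n) (s : S.carrier) : ‖x.1 s‖ ≤ ‖ι s‖ := by
  exact (IsUCP.norm_apply_le x.2 s).trans ((hι 1 _).trans_le (norm_opMatrix_one_le (ι s)))

/-- Uniform limits of elements of the operator system are elements of the operator system. -/
theorem mem_range_hat_of_approx (hκ : Cardinal.aleph0 ≤ κ)
    {f : (stateSpace κ S).affineSystem.carrier}
    (hf : ∀ ε > 0, ∃ h : S.carrier, ∀ (n : Level κ) (x : (stateSpace κ S).points n),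
      ‖(stateSpace κ S).evalMap n x (f - S.hat κ h)‖ ≤ ε) : ∃ s, S.hat κ s = f := by
  obtain ⟨H, _, _, _, ι, -, hcl, h1, -, hc, hn⟩ := S.exists_rep
  have hι : IsUCP S ι := ⟨h1, fun k b hb => (hc k b).mp hb⟩
  have hpos : ∀ k : ℕ, (0 : ℝ) < 1 / ((k : ℝ) + 1) := fun k => by positivity
  choose h hh using fun k : ℕ => hf _ (hpos k)
  have hanti : ∀ {k N : ℕ}, N ≤ k → 1 / ((k : ℝ) + 1) ≤ 1 / ((N : ℝ) + 1) := fun hNk => by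
    gcongr
  have hcauchy : CauchySeq fun k => ι (h k) := by
    -- The constant 8 is 4 from `norm_rep_le` times 2 from the triangle inequality through `f`.
    refine cauchySeq_of_le_tendsto_0 (fun N : ℕ => 8 * (1 / ((N : ℝ) + 1))) (fun k l N hk hl => ?_)
      (by simpa using tendsto_one_div_add_atTop_nhds_zero_nat.const_mul (8 : ℝ))
    rw [dist_eq_norm, ← map_sub]
    have h2 := S.norm_rep_le hκ hι (s := h k - h l) (C := 2 * (1 / ((N : ℝ) + 1)))
      (by positivity) fun n x => by
        have h3 : x.1 (h k - h l) = (stateSpace κ S).evalMap n x (f - S.hat κ (h l))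
            - (stateSpace κ S).evalMap n x (f - S.hat κ (h k)) := by
          rw [← map_sub, sub_sub_sub_cancel_left, ← map_sub, evalMap_hat]
        rw [h3]
        refine (norm_sub_le _ _).trans ?_
        linarith [(hh l n x).trans (hanti hl), (hh k n x).trans (hanti hk)]
    linarith
  obtain ⟨L, hL⟩ := cauchySeq_tendsto_of_complete hcauchy
  -- Here the norm closedness of the operator system is essential.
  obtain ⟨s, rfl⟩ := hcl.mem_of_tendsto hL (Eventually.of_forall fun k => ⟨h k, rfl⟩)
  refine ⟨s, affineSystem_ext fun n x => (sub_eq_zero.mp ?_).symm⟩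
  rw [← map_sub, ← norm_le_zero_iff]
  have hlim : Tendsto (fun k : ℕ => 1 / ((k : ℝ) + 1) + ‖ι (h k) - ι s‖) atTop (𝓝 0) := by
    simpa using tendsto_one_div_add_atTop_nhds_zero_nat.add
      (tendsto_iff_norm_sub_tendsto_zero.mp hL)
  refine ge_of_tendsto' hlim fun k => ?_
  have h3 : (stateSpace κ S).evalMap n x (f - S.hat κ s)
      = (stateSpace κ S).evalMap n x (f - S.hat κ (h k)) + x.1 (h k - s) := by
    rw [← evalMap_hat, ← map_add, map_sub (S.hat κ), sub_add_sub_cancel]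
  rw [h3, ← map_sub]
  exact (norm_add_le _ _).trans (add_le_add (hh k n x) (S.norm_apply_le_norm_rep hn x _))

/-- Every continuous affine nc function on the nc state space comes from the operator system. -/
theorem hat_surjective (hκ : Cardinal.aleph0 ≤ κ) : Function.Surjective (S.hat κ) := by
  have hsa : ∀ f : (stateSpace κ S).affineSystem.carrier, star f = f → ∃ s, S.hat κ s = f := by
    intro f hf
    obtain ⟨n, ⟨e⟩⟩ := Level.exists_equiv (κ := κ) PUnit.{u + 1}
      ((Cardinal.lt_aleph0_of_finite _).le.trans hκ)
    let _ : Unique n.Index := e.symm.unique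
    refine S.mem_range_hat_of_approx hκ fun ε hε => ?_
    -- The quarter absorbs the factor 4 lost in `norm_evalMap_le` when passing from one-dimensional
    -- states to operator norms at all levels.
    obtain ⟨h, hh⟩ := S.exists_hat_approx hκ (n := n) hf (ε := ε / 4) (by positivity)
    refine ⟨h, fun p x => ?_⟩
    have h1 := norm_evalMap_le hκ (by positivity) hh p x
    linarith
  intro f
  obtain ⟨s, hs⟩ := hsa (f + star f) (by rw [star_add, star_star, add_comm])
  -- Decomposition into self-adjoint parts: 2f = (f + f*) + i · i(f* − f).
  obtain ⟨t, ht⟩ := hsa (Complex.I • (star f - f)) (by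
    rw [star_smul, star_sub, star_star, Complex.star_def, Complex.conj_I, neg_smul, ← smul_neg,
      neg_sub])
  refine ⟨(2⁻¹ : ℂ) • (s + Complex.I • t), ?_⟩
  rw [map_smul, map_add, map_smul, hs, ht, smul_smul, Complex.I_mul_I]
  module

/-! ### The natural isomorphism on operator systems, and the duality -/

/-- The canonical map `s ↦ ŝ` as a linear isomorphism. -/
def hatEquiv (hκ : Cardinal.aleph0 ≤ κ) (S : OperatorSystem.{u}) :
    S.carrier ≃ₗ[ℂ] (stateSpace κ S).affineSystem.carrier :=
  LinearEquiv.ofBijective (S.hat κ) ⟨S.hat_injective hκ, S.hat_surjective hκ⟩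

/-- An operator system is isomorphic to the continuous affine nc functions on its nc state
space. -/
def hatIso (hκ : Cardinal.aleph0 ≤ κ) (S : OperatorSystem.{u}) :
    S ≅ (stateSpace κ S).affineSystem where
  hom := { toLinearMap := S.hat κ
           map_one := S.hat_one
           map_cone := fun _ a => (S.mem_cone_iff hκ a).mp }
  inv := { toLinearMap := (S.hatEquiv hκ).symm
           map_one := (LinearEquiv.symm_apply_eq _).mpr S.hat_one.symm
           map_cone := fun k a ha => (S.mem_cone_iff hκ _).mpr (by
             convert ha
             ext i j : 2
             exact (S.hatEquiv hκ).apply_symm_apply _) }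
  hom_inv_id := UCPMap.ext (LinearMap.ext fun s => (S.hatEquiv hκ).symm_apply_apply s)
  inv_hom_id := UCPMap.ext (LinearMap.ext fun s => (S.hatEquiv hκ).apply_symm_apply s)

/-- The natural isomorphism between an operator system and the continuous affine nc functions on its
nc state space. -/
def hatNatIso (hκ : Cardinal.aleph0 ≤ κ) :
    𝟭 OperatorSystem.{u} ≅ stateFunctor κ ⋙ affineFunctor κ :=
  NatIso.ofComponents (fun S => hatIso hκ S) fun _ => rfl

end OperatorSystem

end NCConvex

end

theorem mainTheorem7 (κ : Cardinal.{u}) (hκ : Cardinal.aleph0 ≤ κ) :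
    (∀ S : OperatorSystem.{u},
      ∃ k : S.carrier →ₗ[ℂ] (stateSpace κ S).affineSystem.carrier,
        (∀ (s : S.carrier) (n : Level κ) (x : (stateSpace κ S).points n),
          (stateSpace κ S).evalAt n x (k s) = x.1 s) ∧
        Function.Bijective k ∧ k 1 = 1 ∧ (∀ s, k (star s) = star (k s)) ∧
        ∀ (m : ℕ) (a : Matrix (Fin m) (Fin m) S.carrier),
          a ∈ S.cone m ↔ a.map k ∈ (stateSpace κ S).affineSystem.cone m) ∧
    (∃ (η : 𝟭 (CompactNCConvexSet κ)ᵒᵖ ≅ affineFunctor κ ⋙ stateFunctor κ)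
        (ε : stateFunctor κ ⋙ affineFunctor κ ≅ 𝟭 OperatorSystem.{u}),
      (∀ (K : CompactNCConvexSet κ) (n : Level κ) (x : K.points n) (a : K.affineSystem.carrier),
        (CompactNCConvexSet.AffineMap.toFun (η.inv.app (Opposite.op K)).unop n x).1 a
          = K.evalAt n x a) ∧
      (∀ (S : OperatorSystem.{u}) (s : S.carrier) (n : Level κ) (x : (stateSpace κ S).points n),
        (stateSpace κ S).evalAt n x (UCPMap.toLinearMap (ε.inv.app S) s) = x.1 s)) ∧
    (affineFunctor κ).IsEquivalence ∧ (stateFunctor κ).IsEquivalence := by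

  refine ⟨fun S => ⟨S.hat κ, fun _ _ _ => rfl, ⟨S.hat_injective hκ, S.hat_surjective hκ⟩,
    S.hat_one, S.hat_star, fun m a => S.mem_cone_iff hκ a⟩,
    ⟨(CompactNCConvexSet.evalNatIso hκ).symm, (OperatorSystem.hatNatIso hκ).symm,
      fun _ _ _ _ => rfl, fun _ _ _ _ => rfl⟩, ?_, ?_⟩
  -- No triangle identity has to be checked: two natural isomorphisms suffice, since one of them can
  -- be adjusted to form an adjoint equivalence.
  · exact (CategoryTheory.Equivalence.mk (affineFunctor κ) (stateFunctor κ)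
      (CompactNCConvexSet.evalNatIso hκ).symm
      (OperatorSystem.hatNatIso hκ).symm).isEquivalence_functor
  · exact (CategoryTheory.Equivalence.mk (affineFunctor κ) (stateFunctor κ)
      (CompactNCConvexSet.evalNatIso hκ).symm
      (OperatorSystem.hatNatIso hκ).symm).isEquivalence_inverse
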